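/- Let $n\ge 0$, let $a=(a_1,\dots,a_n)$ be a tuple of natural numbers, $|x|:=x_1+\dots+x_n$, and let $m,m'$ be integers with $0\le m\le m'\le|a|$. The truncated box is $$B=B_m^{m'}(a)=\{x\in\mathbb Z^n:\ 0\le x\le a,\ m\le|x|\le m'\}.$$ A function $f:B\to\mathbb R$ is a *TP-function* if, with $1_q$ denoting the $q$th unit vector, $$f(x+1_i+1_k)+f(x+1_j)=\max\{f(x+1_i+1_j)+f(x+1_k),\ f(x+1_i)+f(x+1_j+1_k)\}$$ for all $x$ and $i<j<k$ such that all six arguments lie in $B$, and $$f(x+1_i+1_k)+f(x+1_j+1_\ell)=\max\{f(x+1_i+1_j)+f(x+1_k+1_\ell),\ f(x+1_i+1_\ell)+f(x+1_j+1_k)\}$$ for all $x$ and $i<j<k<\ell$ such that all six arguments lie in $B$. A subset $\mathcal B\subseteq B$ is a *TP-basis* if the restriction map from the set of TP-functions on $B$ to $\mathbb R^{\mathcal B}$ is a bijection. For a nonzero integer vector $x$ with $0\le x\le a$ let $c(x)$ and $d(x)$ be the first and last elements of its support. Such an $x$ is a *fint* if $x_i=a_i$ for all $c(x)<i<d(x)$;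 it is a *sint* if it is not a fint and $x=x'+x''$ for fints $x',x''$ with $d(x')<c(x'')$ and $x'_i=a_i$ for all $i<d(x')$. Let $Int(a;p)$ and $Sint(a;p)$ be the sets of fints and sints of size $|x|=p$. **Theorem A.** The set $\mathcal B=Sint(a;m)\cup Int(a;m)\cup Int(a;m+1)\cup\dots\cup Int(a;m')$, together with the zero vector when $m=0$, is a TP-basis for $B_m^{m'}(a)$. **Theorem A′ (Boolean version).** Let $0\le m\le m'\le n$ and let $C=\{S\subseteq[n]: m\le|S|\le m'\}$. TP-functions $f:C\to\mathbb R$ are defined by $$f(X\cup\{i,k\})+f(X\cup\{j\})=\max\{f(X\cup\{i,j\})+f(X\cup\{k\}),\ f(X\cup\{i\})+f(X\cup\{j,k\})\}$$ for $i<j<k$ in $[n]$, $X\subseteq[n]\setminus\{i,j,k\}$, and $$f(X\cup\{i,k\})+f(X\cup\{j,\ell\})=\max\{f(X\cup\{i,j\})+f(X\cup\{k,\ell\}),\ f(X\cup\{i,\ell\})+f(X\cup\{j,k\})\}$$ for $i<j<k<\ell$ in $[n]$, $X\subseteq[n]\setminus\{i,j,k,\ell\}$, whenever all six sets lie in $C$.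 Let $\mathcal I_p$ be the set of $p$-element nonempty intervals $[c..d]\subseteq[n]$, let $\mathcal S_p$ be the set of $p$-element sets $[1..d_1]\cup[c_2..d_2]$ with $1\le d_1$, $d_1+1<c_2\le d_2\le n$, and let $\mathcal B=\mathcal S_m\cup\mathcal I_m\cup\mathcal I_{m+1}\cup\dots\cup\mathcal I_{m'}$. Then restriction to $\mathcal B\subseteq C$ is a bijection onto $\mathbb R^{\mathcal B}$ from the set of TP-functions $f$ on $C$, subject to $f(\emptyset)=0$ when $m=0$. Equivalently, without this normalization, restriction to $\mathcal B$, together with $\emptyset$ when $m=0$, is a bijection from the set of all TP-functions on $C$ onto the set of all real functions on that set. -/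

import Mathlib

namespace TropicalPlucker

/-- Restriction of a real function on `D` to a subset `E` of `D`. -/
def restrictTo {α : Type*} {D E : Set α} (h : E ⊆ D) (f : D → ℝ) : E → ℝ :=
  fun y => f ⟨y.1, h y.2⟩

section Box

variable {n : ℕ}

/-- The size `|x| = x₁ + ... + xₙ` of a vector. -/
def size (x : Fin n → ℕ) : ℕ := ∑ i, x i

/-- The `q`-th unit base vector `1_q`. -/
def unitVec (q : Fin n) : Fin n → ℕ := Pi.single q 1

/-- The truncated box: integer vectors `x` with `0 ≤ x ≤ a` and `m ≤ |x| ≤ m'`. -/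
def truncBox (a : Fin n → ℕ) (m m' : ℕ) : Set (Fin n → ℕ) :=
  {x | x ≤ a ∧ m ≤ size x ∧ size x ≤ m'}

/-- The TP3-relation for all `x` and `i < j < k` such that all six vectors belong to `B`. -/
def TP3 {B : Set (Fin n → ℕ)} (f : B → ℝ) : Prop :=
  ∀ (x : Fin n → ℕ) (i j k : Fin n), i < j → j < k →
    ∀ (hik : x + unitVec i + unitVec k ∈ B) (hj : x + unitVec j ∈ B)
      (hij : x + unitVec i + unitVec j ∈ B) (hk : x + unitVec k ∈ B)
      (hi : x + unitVec i ∈ B) (hjk : x + unitVec j + unitVec k ∈ B),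
      f ⟨_, hik⟩ + f ⟨_, hj⟩ = max (f ⟨_, hij⟩ + f ⟨_, hk⟩) (f ⟨_, hi⟩ + f ⟨_, hjk⟩)

/-- The TP4-relation for all `x` and `i < j < k < l` such that all six vectors belong to `B`. -/
def TP4 {B : Set (Fin n → ℕ)} (f : B → ℝ) : Prop :=
  ∀ (x : Fin n → ℕ) (i j k l : Fin n), i < j → j < k → k < l →
    ∀ (hik : x + unitVec i + unitVec k ∈ B) (hjl : x + unitVec j + unitVec l ∈ B)
      (hij : x + unitVec i + unitVec j ∈ B) (hkl : x + unitVec k + unitVec l ∈ B)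
      (hil : x + unitVec i + unitVec l ∈ B) (hjk : x + unitVec j + unitVec k ∈ B),
      f ⟨_, hik⟩ + f ⟨_, hjl⟩ = max (f ⟨_, hij⟩ + f ⟨_, hkl⟩) (f ⟨_, hil⟩ + f ⟨_, hjk⟩)

/-- The set of tropical Plücker functions on the truncated box. -/
def tpFunctions (a : Fin n → ℕ) (m m' : ℕ) : Set (truncBox a m m' → ℝ) :=
  {f | TP3 f ∧ TP4 f}

/-- A TP-basis: a subset of the truncated box such that restriction is a bijection from the
tropical Plücker functions onto all real functions on the subset. -/
def IsTPBasis (a : Fin n → ℕ) (m m' : ℕ) (S : Set (Fin n → ℕ)) : Prop :=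
  ∃ h : S ⊆ truncBox a m m', Set.BijOn (restrictTo h) (tpFunctions a m m') Set.univ

/-- A fuzzy-interval (fint) of the box `B(a)`: a nonzero vector `x ≤ a`, with first and last
support elements `c` and `d`, such that `x i = a i` for all `c < i < d`. -/
def IsFint (a x : Fin n → ℕ) : Prop :=
  x ≤ a ∧ ∃ c d : Fin n, IsLeast (Function.support x) c ∧ IsGreatest (Function.support x) d ∧
    ∀ i, c < i → i < d → x i = a i

/-- A sesquialteral fuzzy-interval (sint) of the box `B(a)`: not a fint, and the sum of two fints
`x'` and `x''` with `d(x') < c(x'')` and `x' i = a i` for all `i < d(x')`. -/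
def IsSint (a x : Fin n → ℕ) : Prop :=
  x ≤ a ∧ ¬ IsFint a x ∧
    ∃ x' x'' : Fin n → ℕ, IsFint a x' ∧ IsFint a x'' ∧ x = x' + x'' ∧
      ∃ d' c'' : Fin n, IsGreatest (Function.support x') d' ∧
        IsLeast (Function.support x'') c'' ∧ d' < c'' ∧ ∀ i, i < d' → x' i = a i

/-- The fints of size `p`. -/
def fints (a : Fin n → ℕ) (p : ℕ) : Set (Fin n → ℕ) := {x | IsFint a x ∧ size x = p}

/-- The sints of size `p`. -/
def sints (a : Fin n → ℕ) (p : ℕ) : Set (Fin n → ℕ) := {x | IsSint a x ∧ size x = p}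

/-- The standard basis; the zero vector is included when `m = 0`. -/
def standardBasis (a : Fin n → ℕ) (m m' : ℕ) : Set (Fin n → ℕ) :=
  sints a m ∪ (⋃ p ∈ Set.Icc m m', fints a p) ∪ {x | m = 0 ∧ x = 0}

end Box

section Cube

/-- The truncated Boolean cube: subsets `S` of `[n]` with `m ≤ |S| ≤ m'`. -/
def truncCube (n m m' : ℕ) : Set (Finset (Fin n)) := {S | m ≤ S.card ∧ S.card ≤ m'}

variable {n : ℕ}

/-- The Boolean TP3-relation, for `i < j < k` and `X ⊆ [n] - {i,j,k}` such that all six sets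
belong to `C`. -/
def BoolTP3 {C : Set (Finset (Fin n))} (f : C → ℝ) : Prop :=
  ∀ (X : Finset (Fin n)) (i j k : Fin n), i < j → j < k → i ∉ X → j ∉ X → k ∉ X →
    ∀ (hik : X ∪ {i, k} ∈ C) (hj : X ∪ {j} ∈ C) (hij : X ∪ {i, j} ∈ C)
      (hk : X ∪ {k} ∈ C) (hi : X ∪ {i} ∈ C) (hjk : X ∪ {j, k} ∈ C),
      f ⟨_, hik⟩ + f ⟨_, hj⟩ = max (f ⟨_, hij⟩ + f ⟨_, hk⟩) (f ⟨_, hi⟩ + f ⟨_, hjk⟩)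

/-- The Boolean TP4-relation, for `i < j < k < l` and `X ⊆ [n] - {i,j,k,l}` such that all six
sets belong to `C`. -/
def BoolTP4 {C : Set (Finset (Fin n))} (f : C → ℝ) : Prop :=
  ∀ (X : Finset (Fin n)) (i j k l : Fin n), i < j → j < k → k < l →
    i ∉ X → j ∉ X → k ∉ X → l ∉ X →
    ∀ (hik : X ∪ {i, k} ∈ C) (hjl : X ∪ {j, l} ∈ C) (hij : X ∪ {i, j} ∈ C)
      (hkl : X ∪ {k, l} ∈ C) (hil : X ∪ {i, l} ∈ C) (hjk : X ∪ {j, k} ∈ C),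
      f ⟨_, hik⟩ + f ⟨_, hjl⟩ = max (f ⟨_, hij⟩ + f ⟨_, hkl⟩) (f ⟨_, hil⟩ + f ⟨_, hjk⟩)

/-- The set of tropical Plücker functions on the truncated Boolean cube. -/
def boolTPFunctions (n m m' : ℕ) : Set (truncCube n m m' → ℝ) :=
  {f | BoolTP3 f ∧ BoolTP4 f}

/-- The tropical Plücker functions on the truncated Boolean cube that vanish at the empty set
whenever the empty set belongs to the truncated cube, that is, whenever `m = 0`. -/
def boolTPFunctionsZero (n m m' : ℕ) : Set (truncCube n m m' → ℝ) :=
  {f | f ∈ boolTPFunctions n m m' ∧ ∀ h : ∅ ∈ truncCube n m m', f ⟨∅, h⟩ = 0}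

/-- The (nonempty) intervals `[c..d]` with `p` elements. -/
def intervals (n p : ℕ) : Set (Finset (Fin n)) :=
  {S | (∃ c d : Fin n, c ≤ d ∧ S = Finset.Icc c d) ∧ S.card = p}

/-- The sesquialteral intervals `[1..d₁] ∪ [c₂..d₂]`, `d₁ + 1 < c₂`, with `p` elements. -/
def sesquiIntervals (n p : ℕ) : Set (Finset (Fin n)) :=
  {S | (∃ d₁ c₂ d₂ : Fin n, (d₁ : ℕ) + 1 < (c₂ : ℕ) ∧ c₂ ≤ d₂ ∧
    S = Finset.Iic d₁ ∪ Finset.Icc c₂ d₂) ∧ S.card = p}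

/-- The sesquialteral intervals of size `m` and the nonempty intervals of sizes `m, ..., m'`. -/
def boolBasis (n m m' : ℕ) : Set (Finset (Fin n)) :=
  sesquiIntervals n m ∪ ⋃ p ∈ Set.Icc m m', intervals n p

end Cube

end TropicalPlucker

namespace TropicalPlucker

variable {n : ℕ}

/-! A new first coordinate brings every vector of the truncated box up to size `m'`. With cap `m' -
m` on it, `B_m^{m'}(a)` becomes the layer of size `m'` of one larger box, and TP3 and TP4 merge into
TP4 on that layer: TP3 is the case in which the new coordinate is the first index. The standard
basis becomes the set of vectors satisfying `Avoids4`, so a single layer remains to be treated.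

Uniqueness. A vector that violates `Avoids4` occurs in a TP4-relation whose other five vectors have
smaller `rank` (`exists_exchange`), and the relation can be solved for its value. Induction on
`rank` (`exchange_induction`) determines the function from its values on the basis.

Existence. The tropical function is a limit of logarithms of genuine Plücker functions. Attach a row
of `ℝ^m` to each unit position of the box and let `P x` be the minor on the first `x i` rows of each
block `i`. Minors satisfy the three-term Plücker relation (`volForm_plucker`). The rows can be
chosen one at a time so that the minors of basis vectors take any prescribed nonzero values
(`exists_rows`): each new row solves a triangular linear system. Prescribe `exp ((k + 1) g x)`. The
relations have no minus signs, so the same induction shows that every minor is positive and that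
`log P / (k + 1)` converges; in the limit sums become maxima and products become sums
(`exists_isTropicalPlucker`).

The Boolean version is the case `a = 1`, through indicator vectors and supports. -/

/-! ### Unit vectors and sizes. -/

theorem unitVec_apply (q i : Fin n) : unitVec q i = if i = q then 1 else 0 := by
  simp [unitVec, Pi.single_apply]

theorem unitVec_self (q : Fin n) : unitVec q q = 1 := by simp [unitVec_apply]

theorem unitVec_of_ne {q i : Fin n} (h : i ≠ q) : unitVec q i = 0 := by simp [unitVec_apply, h]

theorem size_add (x y : Fin n → ℕ) : size (x + y) = size x + size y := by
  simp [size, Finset.sum_add_distrib]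

theorem size_unitVec (q : Fin n) : size (unitVec q) = 1 := by
  simp [size, unitVec]

theorem le_size (x : Fin n → ℕ) (i : Fin n) : x i ≤ size x :=
  Finset.single_le_sum (f := x) (fun _ _ => Nat.zero_le _) (Finset.mem_univ i)

theorem eq_of_le_of_size_eq {x y : Fin n → ℕ} (h : x ≤ y) (hs : size x = size y) : x = y := by
  funext i
  exact (Finset.sum_eq_sum_iff_of_le (fun i _ => h i)).1 hs i (Finset.mem_univ i)

theorem exists_add_unitVec {x : Fin n → ℕ} {d : Fin n} (h : x d ≠ 0) :
    ∃ y, x = y + unitVec d := by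
  refine ⟨x - unitVec d, ?_⟩
  funext i
  by_cases hi : i = d
  · subst hi
    simp only [Pi.add_apply, Pi.sub_apply, unitVec_self]
    omega
  · simp [unitVec_of_ne hi]

/-! ### Forbidden patterns and descent along exchange relations. -/

/-- No positions `i < j < k` carry a nonzero, a deficient and a nonzero entry of `x`. -/
def Avoids3 (a x : Fin n → ℕ) : Prop :=
  ∀ i j k : Fin n, i < j → j < k → x i ≠ 0 → x k ≠ 0 → a j ≤ x j

/-- No positions `q < i < j < k` carry a deficient, a nonzero, a deficient and a nonzero
entry of `x`. -/
def Avoids4 (a x : Fin n → ℕ) : Prop :=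
  ∀ q i j k : Fin n, q < i → i < j → j < k → x q < a q → x i ≠ 0 → x k ≠ 0 → a j ≤ x j

/-- The part of `x` beyond its first deficient position. -/
noncomputable def rest (a x : Fin n → ℕ) : Fin n → ℕ :=
  open Classical in fun i => if ∃ q < i, x q < a q then x i else 0

/-- A number dominated by the diameter of the support, and then by the end multiplicities. -/
def spread (y : Fin n → ℕ) : ℕ :=
  Finset.univ.sup fun p : Fin n × Fin n =>
    if y p.1 ≠ 0 ∧ y p.2 ≠ 0 then
      ((p.2 : ℕ) - (p.1 : ℕ)) * (2 * size y + 1) + (y p.1 + y p.2) else 0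

/-- A unit moves from an end of the support to its interior. The factor `2 * size y + 1` exceeds the
sum of any two entries, so pairs closer together than `c, d` cannot reach the old value; the pair
`(c, d)` itself loses one unit. -/
theorem spread_lt {y y' : Fin n → ℕ} {c j d e : Fin n} (hcj : c < j) (hjd : j < d)
    (hy : ∀ i, y i ≠ 0 → c ≤ i ∧ i ≤ d) (hc : y c ≠ 0) (hd : y d ≠ 0) (he : e = c ∨ e = d)
    (h : y' + unitVec e = y + unitVec j) : spread y' < spread y := by
  have hs : size y' = size y := by
    have := congrArg size h
    simpa [size_add, size_unitVec] using this
  have hcd : c < d := hcj.trans hjd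
  have hlow : ((d : ℕ) - (c : ℕ)) * (2 * size y + 1) + (y c + y d) ≤ spread y := by
    have := Finset.le_sup (f := fun p : Fin n × Fin n =>
      if y p.1 ≠ 0 ∧ y p.2 ≠ 0 then
        ((p.2 : ℕ) - (p.1 : ℕ)) * (2 * size y + 1) + (y p.1 + y p.2) else 0)
      (Finset.mem_univ (c, d))
    simp only [hc, hd, ne_eq, not_false_eq_true, and_self, if_true] at this
    exact this
  refine lt_of_lt_of_le ?_ hlow
  have hpt : ∀ i, y' i + unitVec e i = y i + unitVec j i := fun i => congrFun h i
  rw [spread, Finset.sup_lt_iff (by simp only [Nat.bot_eq_zero]; omega)]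
  rintro ⟨i, k⟩ -
  simp only [hs]
  split_ifs with hik
  · have hsupp : ∀ i, y' i ≠ 0 → c ≤ i ∧ i ≤ d := by
      intro i hi
      by_cases hij : i = j
      · subst hij; exact ⟨hcj.le, hjd.le⟩
      · have := hpt i
        rw [unitVec_of_ne hij] at this
        exact hy i (by omega)
    have h1 := hsupp i hik.1
    have h2 := hsupp k hik.2
    have hi := le_size y' i
    have hk := le_size y' k
    rcases Nat.lt_or_ge ((k : ℕ) - i) ((d : ℕ) - c) with hlt | hge
    · have : ((k : ℕ) - i + 1) * (2 * size y + 1) ≤ ((d : ℕ) - c) * (2 * size y + 1) :=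
        Nat.mul_le_mul_right _ hlt
      rw [add_mul] at this
      omega
    · have hic : i = c := by
        apply Fin.ext; have := h1.1; have := h2.2; simp only [Fin.le_def, Fin.lt_def] at *; omega
      have hkd : k = d := by
        apply Fin.ext; have := h1.1; have := h2.2; simp only [Fin.le_def, Fin.lt_def] at *; omega
      subst hic hkd
      have e1 := hpt i
      have e2 := hpt k
      rw [unitVec_of_ne hcj.ne] at e1
      rw [unitVec_of_ne hjd.ne'] at e2
      rcases he with rfl | rfl
      · rw [unitVec_self] at e1
        omega
      · rw [unitVec_self] at e2
        omega
  · omega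

/-- The rank by which the exchange relations descend. -/
noncomputable def rank (a x : Fin n → ℕ) : ℕ ×ₗ ℕ :=
  toLex (size (rest a x), spread (rest a x))

theorem exists_first_deficient {a x : Fin n → ℕ} {p : Fin n} (hp : x p < a p) :
    ∃ q ≤ p, x q < a q ∧ ∀ i < q, a i ≤ x i := by
  obtain ⟨q, hq, hmin⟩ := WellFounded.has_min (wellFounded_lt (α := Fin n))
    {i | x i < a i} ⟨p, hp⟩
  refine ⟨q, not_lt.1 (hmin p hp), hq, fun i hi => ?_⟩
  by_contra hc
  exact hmin i (not_le.1 hc) hi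

theorem rest_apply {a x : Fin n → ℕ} {q : Fin n} (hq : x q < a q) (hlt : ∀ i < q, a i ≤ x i)
    (i : Fin n) : rest a x i = if q < i then x i else 0 := by
  have : (∃ q' < i, x q' < a q') ↔ q < i := by
    constructor
    · rintro ⟨q', h1, h2⟩
      refine lt_of_le_of_lt ?_ h1
      by_contra hc
      exact absurd (hlt q' (not_le.1 hc)) (not_le.2 h2)
    · exact fun h => ⟨q, h, hq⟩
  simp [rest, this]

/-- Raising the first deficient entry puts more of the fixed total on the positions up to `q`, hence
less beyond them, and the first component of the rank drops. -/
theorem rank_lt_of_add_first {a x x' : Fin n → ℕ} {q : Fin n} (hq : x q < a q)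
    (hlt : ∀ i < q, a i ≤ x i) (hle : ∀ i < q, x' i = x i) (hq' : x q < x' q)
    (hs : size x' = size x) : rank a x' < rank a x := by
  rw [rank, rank, Prod.Lex.toLex_lt_toLex]
  left
  have h1 : size (rest a x) + ∑ i ∈ Finset.Iic q, x i = size x := by
    simp only [size, rest_apply hq hlt]
    rw [← Finset.sum_filter_add_sum_filter_not Finset.univ (fun i => q < i) x,
      Finset.sum_filter]
    congr 1
    apply Finset.sum_congr _ (fun _ _ => rfl)
    ext i; simp
  -- Positions before `q` are full in `x'` too, so `rest a x'` vanishes up to `q`. It may vanish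
  -- further if `q` has become full, hence only an inequality.
  have h2 : size (rest a x') + ∑ i ∈ Finset.Iic q, x' i ≤ size x' := by
    simp only [size]
    rw [← Finset.sum_filter_add_sum_filter_not Finset.univ (fun i => q < i) x']
    have e : Finset.univ.filter (fun i => ¬ q < i) = Finset.Iic q := by ext i; simp
    rw [e, Finset.sum_filter]
    gcongr with i hi
    rw [rest]
    split_ifs with h3 h4 h4
    · exact le_rfl
    · obtain ⟨p, hp, hpa⟩ := h3
      have hpq : p < q := lt_of_lt_of_le hp (not_lt.1 h4)
      have := hlt p hpq
      have := hle p hpq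
      omega
    · exact Nat.zero_le _
    · exact le_rfl
  have h3 : ∑ i ∈ Finset.Iic q, x i < ∑ i ∈ Finset.Iic q, x' i := by
    apply Finset.sum_lt_sum
    · intro i hi
      rcases (Finset.mem_Iic.1 hi).lt_or_eq with h | h
      · exact (hle i h).ge
      · subst h; exact hq'.le
    · exact ⟨q, by simp, hq'⟩
  omega

/-- The move happens entirely beyond the first deficient position, so it keeps the size of `rest`
and lowers the second component, `spread`. -/
theorem rank_lt_of_move {a x x' : Fin n → ℕ} {q c j d e : Fin n} (hq : x q < a q)
    (hlt : ∀ i < q, a i ≤ x i) (hqc : q < c) (hcj : c < j) (hjd : j < d)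
    (hx : ∀ i, q < i → x i ≠ 0 → c ≤ i ∧ i ≤ d) (hc : x c ≠ 0) (hd : x d ≠ 0)
    (he : e = c ∨ e = d) (h : x' + unitVec e = x + unitVec j) : rank a x' < rank a x := by
  have hqe : q < e := by
    rcases he with rfl | rfl
    · exact hqc
    · exact hqc.trans (hcj.trans hjd)
  have hqj : q < j := hqc.trans hcj
  have hpt : ∀ i, x' i + unitVec e i = x i + unitVec j i := fun i => congrFun h i
  have hle : ∀ i ≤ q, x' i = x i := by
    intro i hi
    have := hpt i
    rwa [unitVec_of_ne (lt_of_le_of_lt hi hqe).ne, unitVec_of_ne (lt_of_le_of_lt hi hqj).ne]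
      at this
  have hr : rest a x' + unitVec e = rest a x + unitVec j := by
    have hq1 : x' q < a q := by rw [hle q le_rfl]; exact hq
    have hlt1 : ∀ i < q, a i ≤ x' i := fun i hi => by rw [hle i hi.le]; exact hlt i hi
    funext i
    simp only [Pi.add_apply, rest_apply hq hlt, rest_apply hq1 hlt1]
    split_ifs with hi
    · exact hpt i
    · have hi := not_lt.1 hi
      rw [unitVec_of_ne (lt_of_le_of_lt hi hqe).ne, unitVec_of_ne (lt_of_le_of_lt hi hqj).ne]
  rw [rank, rank, Prod.Lex.toLex_lt_toLex]
  refine Or.inr ⟨?_, spread_lt hcj hjd ?_ ?_ ?_ he hr⟩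
  · have := congrArg size hr
    simpa [size_add, size_unitVec] using this
  · intro i hi
    rw [rest_apply hq hlt] at hi
    split_ifs at hi with hqi
    · exact hx i hqi hi
    · exact absurd rfl hi
  · rwa [rest_apply hq hlt, if_pos hqc]
  · rwa [rest_apply hq hlt, if_pos (hqc.trans (hcj.trans hjd))]

/-- Take `q` to be the first deficient position and `c`, `d` the first and last support elements
beyond it; a forbidden pattern then gives a deficient `j` between `c` and `d`. Three of the other
five vectors gain a unit at `q`; the remaining two move a unit from `c` or `d` to `j`. -/
theorem exists_exchange {a x : Fin n → ℕ} (hx : x ≤ a) (h : ¬ Avoids4 a x) :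
    ∃ (X : Fin n → ℕ) (q c j d : Fin n), q < c ∧ c < j ∧ j < d ∧
      X + unitVec q + unitVec c + unitVec j + unitVec d ≤ a ∧ x = X + unitVec c + unitVec d ∧
      rank a (X + unitVec q + unitVec j) < rank a x ∧
      rank a (X + unitVec q + unitVec c) < rank a x ∧
      rank a (X + unitVec j + unitVec d) < rank a x ∧
      rank a (X + unitVec q + unitVec d) < rank a x ∧
      rank a (X + unitVec c + unitVec j) < rank a x := by
  simp only [Avoids4, not_forall, not_le] at h
  obtain ⟨p, i, j, k, hpi, hij, hjk, hp, hi, hk, hj⟩ := h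
  obtain ⟨q, hqp, hq, hlt⟩ := exists_first_deficient hp
  have hqi := lt_of_le_of_lt hqp hpi
  obtain ⟨c, ⟨hqc, hc⟩, hcmin⟩ := WellFounded.has_min (wellFounded_lt (α := Fin n))
    {i | q < i ∧ x i ≠ 0} ⟨i, hqi, hi⟩
  obtain ⟨d, ⟨hqd, hd⟩, hdmax⟩ := WellFounded.has_min (wellFounded_gt (α := Fin n))
    {i | q < i ∧ x i ≠ 0} ⟨i, hqi, hi⟩
  have hcj : c < j := lt_of_le_of_lt (not_lt.1 (hcmin i ⟨hqi, hi⟩)) hij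
  have hjd : j < d := lt_of_lt_of_le hjk (not_lt.1 (hdmax k ⟨hqi.trans (hij.trans hjk), hk⟩))
  have hsupp : ∀ i, q < i → x i ≠ 0 → c ≤ i ∧ i ≤ d := fun i h1 h2 =>
    ⟨not_lt.1 (hcmin i ⟨h1, h2⟩), not_lt.1 (hdmax i ⟨h1, h2⟩)⟩
  obtain ⟨y, rfl⟩ := exists_add_unitVec hd
  have hcd : c < d := hcj.trans hjd
  have hc' : y c ≠ 0 := by simpa [unitVec_of_ne hcd.ne] using hc
  obtain ⟨X, rfl⟩ := exists_add_unitVec hc'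
  have n1 := unitVec_of_ne hqc.ne
  have n2 := unitVec_of_ne hqd.ne
  have n3 := unitVec_of_ne (hqc.trans hcj).ne
  have hqX : X q < a q := by simpa [n1, n2] using hq
  have hjX : X j < a j := by
    simpa [unitVec_of_ne hcj.ne', unitVec_of_ne hjd.ne] using hj
  refine ⟨X, q, c, j, d, hqc, hcj, hjd, ?_, rfl, ?_, ?_, ?_, ?_, ?_⟩
  · intro i
    have hxi := hx i
    simp only [Pi.add_apply] at hxi ⊢
    by_cases h1 : i = q
    · subst h1; rw [unitVec_self, n1, n2, n3]; omega
    · by_cases h2 : i = j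
      · subst h2
        rw [unitVec_self, unitVec_of_ne h1, unitVec_of_ne hcj.ne', unitVec_of_ne hjd.ne]
        omega
      · rw [unitVec_of_ne h1, unitVec_of_ne h2]; omega
  · refine rank_lt_of_add_first hq hlt (fun i hi => ?_) ?_ (by simp [size_add, size_unitVec])
    · simp [unitVec_of_ne hi.ne, unitVec_of_ne (hi.trans hqc).ne, unitVec_of_ne (hi.trans hqd).ne,
        unitVec_of_ne (hi.trans (hqc.trans hcj)).ne]
    · simp [n1, n2, n3, unitVec_self]
  · refine rank_lt_of_add_first hq hlt (fun i hi => ?_) ?_ (by simp [size_add, size_unitVec])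
    · simp [unitVec_of_ne hi.ne, unitVec_of_ne (hi.trans hqc).ne, unitVec_of_ne (hi.trans hqd).ne]
    · simp [n1, n2, unitVec_self]
  · exact rank_lt_of_move hq hlt hqc hcj hjd hsupp hc hd (Or.inl rfl) (by abel)
  · refine rank_lt_of_add_first hq hlt (fun i hi => ?_) ?_ (by simp [size_add, size_unitVec])
    · simp [unitVec_of_ne hi.ne, unitVec_of_ne (hi.trans hqc).ne, unitVec_of_ne (hi.trans hqd).ne]
    · simp [n1, n2, unitVec_self]
  · exact rank_lt_of_move hq hlt hqc hcj hjd hsupp hc hd (Or.inr rfl) (by abel)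

/-! ### Determinants in the exterior algebra and the Plücker relation. -/

open ExteriorAlgebra in
/-- The determinant, as a linear form on the exterior algebra of `ℝ^m`. -/
noncomputable def volForm (m : ℕ) : ExteriorAlgebra ℝ (Fin m → ℝ) →ₗ[ℝ] ℝ :=
  liftAlternating (R := ℝ) (M := Fin m → ℝ) (N := ℝ)
    (Pi.single (M := fun i => (Fin m → ℝ) [⋀^Fin i]→ₗ[ℝ] ℝ) m Matrix.detRowAlternating)

theorem volForm_prod {m : ℕ} (z : Fin m → Fin m → ℝ) :
    volForm m (List.ofFn fun i => ExteriorAlgebra.ι ℝ (z i)).prod = (Matrix.of z).det := by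
  rw [← ExteriorAlgebra.ιMulti_apply, volForm, ExteriorAlgebra.liftAlternating_apply_ιMulti]
  rw [Pi.single_eq_same]
  rfl

theorem ι_mul_prod_eq_zero {V : Type*} [AddCommGroup V] [Module ℝ V] {l : List V} {w : V}
    (h : w ∈ l) : ExteriorAlgebra.ι ℝ w * (l.map (ExteriorAlgebra.ι ℝ)).prod = 0 := by
  obtain ⟨i, rfl⟩ := List.get_of_mem h
  have := ExteriorAlgebra.ι_mul_prod_list (R := ℝ) l.get i
  have e : l.map (ExteriorAlgebra.ι ℝ) = List.ofFn fun i => ExteriorAlgebra.ι ℝ (l.get i) := by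
    conv_lhs => rw [← List.ofFn_get l, List.map_ofFn]
    rfl
  rwa [e]

theorem prod_mul_ι {V : Type*} [AddCommGroup V] [Module ℝ V] (l : List V) (w : V) :
    (l.map (ExteriorAlgebra.ι ℝ)).prod * ExteriorAlgebra.ι ℝ w =
      (-1 : ℝ) ^ l.length • (ExteriorAlgebra.ι ℝ w * (l.map (ExteriorAlgebra.ι ℝ)).prod) := by
  induction l with
  | nil => simp
  | cons u t ih =>
    have h := eq_neg_of_add_eq_zero_left (ExteriorAlgebra.ι_add_mul_swap (R := ℝ) u w)
    simp only [List.map_cons, List.prod_cons, List.length_cons, mul_assoc, ih, mul_smul_comm]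
    rw [← mul_assoc, h, pow_succ]
    simp [mul_assoc]

/-- The three-term Plücker relation for determinants. -/
theorem volForm_plucker {m : ℕ} (l : List (Fin m → ℝ)) (hl : l.length + 2 = m)
    (u₁ u₂ u₃ u₄ : Fin m → ℝ) :
    let D := fun u w => volForm m (ExteriorAlgebra.ι ℝ u *
      (ExteriorAlgebra.ι ℝ w * (l.map (ExteriorAlgebra.ι ℝ)).prod))
    D u₁ u₃ * D u₂ u₄ = D u₁ u₂ * D u₃ u₄ + D u₁ u₄ * D u₂ u₃ := by
  intro D
  obtain ⟨k, X, rfl⟩ : ∃ k, ∃ X : Fin k → Fin m → ℝ, l = List.ofFn X :=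
    ⟨_, l.get, (List.ofFn_get l).symm⟩
  rw [List.length_ofFn] at hl
  subst hl
  have hD : ∀ u w, D u w = (Matrix.of (Matrix.vecCons u (Matrix.vecCons w X))).det := by
    intro u w
    rw [← volForm_prod]
    simp only [D, List.ofFn_succ, List.prod_cons, List.map_ofFn]
    rfl
  let ψ : (Fin (k + 2) → ℝ) →ₗ[ℝ] ℝ := volForm (k + 2) ∘ₗ
    LinearMap.mulRight ℝ (ExteriorAlgebra.ι ℝ u₄ *
      ((List.ofFn X).map (ExteriorAlgebra.ι ℝ)).prod) ∘ₗ ExteriorAlgebra.ι ℝ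
  have hψ : ∀ u, ψ u = D u u₄ := fun u => rfl
  have hψX : ∀ r, ψ (X r) = 0 := by
    intro r
    have hmem : X r ∈ u₄ :: List.ofFn X := by simp [List.mem_ofFn]
    have := ι_mul_prod_eq_zero hmem
    simp only [List.map_cons, List.prod_cons] at this
    rw [hψ]
    simp only [D, this, map_zero]
  -- Cramer's rule expands `det z • u₂` in the rows `u₁, u₃, X` of `z`. The linear form `ψ = D · u₄`
  -- kills the rows of `X`, which leaves the three terms of the relation.
  set z : Fin (k + 2) → Fin (k + 2) → ℝ := Matrix.vecCons u₁ (Matrix.vecCons u₃ X) with hz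
  have hc := Matrix.mulVec_cramer (Matrix.of z).transpose u₂
  have hsum : ∑ r, ((Matrix.of z).updateRow r u₂).det • z r = (Matrix.of z).det • u₂ := by
    rw [Matrix.det_transpose] at hc
    rw [← hc]
    funext s
    simp [Matrix.mulVec, dotProduct, Matrix.cramer_transpose_apply, mul_comm]
  have h2 := congrArg ψ hsum
  rw [map_sum, Fin.sum_univ_succ, Fin.sum_univ_succ] at h2
  have h0 : ∀ r : Fin k, ψ (z r.succ.succ) = 0 := fun r => hψX r
  simp only [map_smul, h0, smul_zero, Finset.sum_const_zero, add_zero] at h2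
  have e1 : (Matrix.of z).updateRow 0 u₂ = Matrix.of (Matrix.vecCons u₂ (Matrix.vecCons u₃ X)) := by
    ext r s
    refine Fin.cases ?_ (fun r => ?_) r
    · simp
    · simp [hz]
  have e2 : (Matrix.of z).updateRow (Fin.succ 0) u₂ =
      Matrix.of (Matrix.vecCons u₁ (Matrix.vecCons u₂ X)) := by
    ext r s
    refine Fin.cases ?_ (fun r => Fin.cases ?_ (fun r => ?_) r) r
    · rw [Matrix.updateRow_ne (Fin.succ_ne_zero _).symm]; simp [hz]
    · simp
    · rw [Matrix.updateRow_ne (by simp [Fin.ext_iff])]; simp [hz]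
  rw [e1, e2] at h2
  have z0 : z 0 = u₁ := rfl
  have z1 : z (Fin.succ 0) = u₃ := rfl
  rw [z0, z1, hψ, hψ, hψ, ← hD, ← hD, hz, ← hD] at h2
  simp only [smul_eq_mul] at h2
  linarith

/-! ### Minors indexed by the vectors of a box. -/

/-- The number of unit positions of the box `B(a)` that precede the block `i`. -/
def offset (a : Fin n → ℕ) (i : Fin n) : ℕ := ∑ j ∈ Finset.Iio i, a j

theorem offset_add_le (a : Fin n → ℕ) {i k : Fin n} (h : i < k) :
    offset a i + a i ≤ offset a k := by
  rw [offset, offset, add_comm, ← Finset.sum_insert (by simp)]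
  apply Finset.sum_le_sum_of_subset
  intro j hj
  simp only [Finset.mem_insert, Finset.mem_Iio] at hj ⊢
  rcases hj with rfl | hj
  · exact h
  · exact hj.trans h

theorem exists_block {a : Fin n → ℕ} {p : ℕ} (hp : p < size a) :
    ∃ q, offset a q ≤ p ∧ p < offset a q + a q := by
  by_contra! hcon
  have key : ∀ k ≤ n, ∑ j ∈ Finset.univ.filter (fun j : Fin n => j.val < k), a j ≤ p := by
    intro k
    induction k with
    | zero => simp
    | succ k ih =>
      intro hk
      have hlt : k < n := hk
      have e1 : Finset.univ.filter (fun j : Fin n => j.val < k + 1) =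
          insert ⟨k, hlt⟩ (Finset.Iio ⟨k, hlt⟩) := by
        ext j
        simp only [Finset.mem_filter, Finset.mem_univ, true_and, Finset.mem_insert,
          Finset.mem_Iio, Fin.ext_iff, Fin.lt_def]
        omega
      have e2 : Finset.univ.filter (fun j : Fin n => j.val < k) = Finset.Iio ⟨k, hlt⟩ := by
        ext j; simp [Fin.lt_def]
      rw [e1, Finset.sum_insert (by simp), add_comm]
      rw [e2] at ih
      exact hcon ⟨k, hlt⟩ (ih hlt.le)
  have := key n le_rfl
  simp only [Fin.is_lt, Finset.filter_true] at this
  exact absurd hp (not_lt.2 this)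

/-- The rows, taken from the sequence `v`, that belong to the vector `x` of the box `B(a)`: the
first `x i` rows of each block `i`. -/
def rowList {V : Type*} (a : Fin n → ℕ) (v : ℕ → V) (x : Fin n → ℕ) : List V :=
  (List.finRange n).flatMap fun i => (List.range (x i)).map fun e => v (offset a i + e)

/-- The exterior product of the rows that belong to `x`. -/
noncomputable def wedge {V : Type*} [AddCommGroup V] [Module ℝ V] (a : Fin n → ℕ) (v : ℕ → V)
    (x : Fin n → ℕ) : ExteriorAlgebra ℝ V :=
  ((rowList a v x).map (ExteriorAlgebra.ι ℝ)).prod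

theorem length_rowList {V : Type*} (a : Fin n → ℕ) (v : ℕ → V) (x : Fin n → ℕ) :
    (rowList a v x).length = size x := by
  simp [rowList, List.length_flatMap, size, Fin.sum_univ_def]

theorem mem_rowList {V : Type*} {a : Fin n → ℕ} {v : ℕ → V} {x : Fin n → ℕ} {w : V} :
    w ∈ rowList a v x ↔ ∃ i, ∃ e < x i, v (offset a i + e) = w := by
  simp [rowList]

theorem rowList_congr {V : Type*} {a : Fin n → ℕ} {v v' : ℕ → V} {x : Fin n → ℕ}
    (h : ∀ i, ∀ e < x i, v (offset a i + e) = v' (offset a i + e)) :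
    rowList a v x = rowList a v' x := by
  unfold rowList
  congr 1
  funext i
  apply List.map_congr_left
  intro e he
  exact h i e (List.mem_range.1 he)

/-- The sign of moving a new row of block `i` to the front. -/
def moveSign (x : Fin n → ℕ) (i : Fin n) : ℝ :=
  (-1) ^ (((List.finRange n).filter (· ≤ i)).map x).sum

theorem moveSign_mul_self (x : Fin n → ℕ) (i : Fin n) : moveSign x i * moveSign x i = 1 := by
  rw [moveSign, ← mul_pow]; simp

theorem moveSign_add_of_lt (x : Fin n → ℕ) {i k : Fin n} (h : i < k) :
    moveSign (x + unitVec k) i = moveSign x i := by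
  unfold moveSign
  congr 2
  apply List.map_congr_left
  intro j hj
  have : j ≤ i := by simpa using hj
  simp [unitVec_of_ne (lt_of_le_of_lt this h).ne]

/-- The new factor stands at the end of block `i`; on its way to the front it passes exactly the old
factors of the blocks up to `i`, with one sign change each. -/
theorem prod_insert_ι {V : Type*} [AddCommGroup V] [Module ℝ V] {b b' : Fin n → List V}
    {i : Fin n} {u : V} (hi : b' i = b i ++ [u]) (hne : ∀ j, j ≠ i → b' j = b j)
    (l : List (Fin n)) (hl : l.Pairwise (· < ·)) (hil : i ∈ l) :
    ((l.flatMap b').map (ExteriorAlgebra.ι ℝ)).prod =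
      (-1 : ℝ) ^ ((l.filter (· ≤ i)).map fun j => (b j).length).sum •
        (ExteriorAlgebra.ι ℝ u * ((l.flatMap b).map (ExteriorAlgebra.ι ℝ)).prod) := by
  induction l with
  | nil => simp at hil
  | cons h t ih =>
    rw [List.pairwise_cons] at hl
    by_cases hh : h = i
    · subst hh
      have ht : t.flatMap b' = t.flatMap b :=
        List.flatMap_congr fun j hj => hne j (hl.1 j hj).ne'
      have hf : t.filter (· ≤ h) = [] := by
        rw [List.filter_eq_nil_iff]
        intro j hj
        simpa using hl.1 j hj
      simp only [List.flatMap_cons, List.map_append, List.prod_append, hi, ht, List.map_cons,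
        List.map_nil, List.prod_cons, List.prod_nil, mul_one, prod_mul_ι]
      simp [hf, mul_assoc]
    · have hit : i ∈ t := by
        rcases List.mem_cons.1 hil with h1 | h1
        · exact absurd h1.symm hh
        · exact h1
      have hhi : h ≤ i := (hl.1 i hit).le
      simp only [List.flatMap_cons, List.map_append, List.prod_append, hne h hh, ih hl.2 hit,
        mul_smul_comm]
      rw [← mul_assoc, prod_mul_ι, List.filter_cons_of_pos (by simpa using hhi)]
      simp only [List.map_cons, List.sum_cons, pow_add, smul_mul_assoc, smul_smul, mul_assoc]
      rw [mul_comm]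

theorem wedge_add_unitVec {V : Type*} [AddCommGroup V] [Module ℝ V] (a : Fin n → ℕ) (v : ℕ → V)
    (x : Fin n → ℕ) (i : Fin n) :
    wedge a v (x + unitVec i) =
      moveSign x i • (ExteriorAlgebra.ι ℝ (v (offset a i + x i)) * wedge a v x) := by
  have := prod_insert_ι (b := fun i => (List.range (x i)).map fun e => v (offset a i + e))
    (b' := fun j => (List.range ((x + unitVec i) j)).map fun e => v (offset a j + e))
    (i := i) (u := v (offset a i + x i)) (by simp [unitVec_self, List.range_succ])
    (fun j hj => by simp [unitVec_of_ne hj]) (List.finRange n) (List.pairwise_lt_finRange n)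
    (List.mem_finRange i)
  simpa [moveSign, wedge, rowList] using this

/-- Extracting the later row `k` first leaves the sign of `i` untouched. Hence each product in a
three-term relation carries the same four signs, and these cancel from the relation. -/
theorem wedge_add_add {V : Type*} [AddCommGroup V] [Module ℝ V] (a : Fin n → ℕ) (v : ℕ → V)
    (x : Fin n → ℕ) {i k : Fin n} (h : i < k) :
    wedge a v (x + unitVec i + unitVec k) =
      (moveSign x i * moveSign x k) • (ExteriorAlgebra.ι ℝ (v (offset a i + x i)) *
        (ExteriorAlgebra.ι ℝ (v (offset a k + x k)) * wedge a v x)) := by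
  rw [add_right_comm, wedge_add_unitVec, wedge_add_unitVec, moveSign_add_of_lt x h]
  simp [unitVec_of_ne h.ne, smul_smul]

/-- The three-term Plücker relations on the vectors of size `m` in the box `B(a)`. -/
def IsPlucker (a : Fin n → ℕ) (m : ℕ) (P : (Fin n → ℕ) → ℝ) : Prop :=
  ∀ (X : Fin n → ℕ) (i j k l : Fin n), i < j → j < k → k < l →
    X + unitVec i + unitVec j + unitVec k + unitVec l ≤ a → size X + 2 = m →
    P (X + unitVec i + unitVec k) * P (X + unitVec j + unitVec l) =
      P (X + unitVec i + unitVec j) * P (X + unitVec k + unitVec l) +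
        P (X + unitVec i + unitVec l) * P (X + unitVec j + unitVec k)

theorem isPlucker_volForm (a : Fin n → ℕ) (m : ℕ) (v : ℕ → Fin m → ℝ) (C : ℝ) :
    IsPlucker a m fun x => C * volForm m (wedge a v x) := by
  intro X i j k l hij hjk hkl _ hX
  have h := volForm_plucker (rowList a v X) (by rw [length_rowList, hX])
    (v (offset a i + X i)) (v (offset a j + X j)) (v (offset a k + X k)) (v (offset a l + X l))
  simp only [] at h
  rw [show ((rowList a v X).map (ExteriorAlgebra.ι ℝ)).prod = wedge a v X from rfl] at h
  simp only [wedge_add_add a v X hij, wedge_add_add a v X hkl, wedge_add_add a v X hjk,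
    wedge_add_add a v X (hij.trans hjk), wedge_add_add a v X (hjk.trans hkl),
    wedge_add_add a v X (hij.trans (hjk.trans hkl)), map_smul, smul_eq_mul]
  linear_combination (C ^ 2 * moveSign X i * moveSign X j * moveSign X k * moveSign X l) * h

/-! ### Initial vectors and unit rows. -/

/-- All positions that belong to `x` are among the first `r` ones. -/
def Below (a : Fin n → ℕ) (r : ℕ) (x : Fin n → ℕ) : Prop :=
  ∀ i, x i ≠ 0 → offset a i + x i ≤ r

/-- The vector that consists of the first `p` positions of the box `B(a)`. -/
def initVec (a : Fin n → ℕ) (p : ℕ) : Fin n → ℕ := fun i => min (a i) (p - offset a i)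

theorem initVec_succ {a : Fin n → ℕ} {p : ℕ} (hp : p < size a) :
    ∃ q, offset a q + initVec a p q = p ∧ initVec a (p + 1) = initVec a p + unitVec q := by
  obtain ⟨q, h1, h2⟩ := exists_block hp
  refine ⟨q, by simp only [initVec]; omega, ?_⟩
  funext i
  simp only [initVec, Pi.add_apply]
  rcases lt_trichotomy i q with h | h | h
  · have := offset_add_le a h
    rw [unitVec_of_ne h.ne]
    omega
  · subst h
    rw [unitVec_self]
    omega
  · have := offset_add_le a h
    rw [unitVec_of_ne h.ne']
    omega

theorem size_initVec {a : Fin n → ℕ} {p : ℕ} (hp : p ≤ size a) : size (initVec a p) = p := by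
  induction p with
  | zero => simp [initVec, size]
  | succ p ih =>
    obtain ⟨q, -, h⟩ := initVec_succ hp
    rw [h, size_add, size_unitVec, ih (by omega)]

theorem eq_initVec_of_below {a x : Fin n → ℕ} {m : ℕ} (hx : x ≤ a) (hm : size x = m)
    (hb : Below a m x) : x = initVec a m := by
  have hle : m ≤ size a := hm ▸ Finset.sum_le_sum fun i _ => hx i
  refine eq_of_le_of_size_eq (fun i => ?_) (by rw [hm, size_initVec hle])
  have h1 : x i ≤ a i := hx i
  have h2 := hb i
  simp only [initVec]
  omega

/-- Each further row is moved to the front, whence the reversed order. Together with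
`volForm_unitRow` this shows that the minor of the initial vector is nonzero. -/
theorem wedge_initVec {V : Type*} [AddCommGroup V] [Module ℝ V] (a : Fin n → ℕ) (v : ℕ → V)
    {p : ℕ} (hp : p ≤ size a) :
    ∃ s : ℝ, s ≠ 0 ∧ wedge a v (initVec a p) =
      s • (((List.range p).reverse.map fun j => ExteriorAlgebra.ι ℝ (v j))).prod := by
  induction p with
  | zero =>
    have : rowList a v (initVec a 0) = [] := by
      rw [← List.length_eq_zero_iff, length_rowList, size_initVec hp]
    exact ⟨1, one_ne_zero, by simp [wedge, this]⟩
  | succ p ih =>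
    obtain ⟨s, hs, h⟩ := ih (by omega)
    obtain ⟨q, hq, hi⟩ := initVec_succ hp
    refine ⟨moveSign (initVec a p) q * s, mul_ne_zero ?_ hs, ?_⟩
    · exact left_ne_zero_of_mul_eq_one (moveSign_mul_self _ _)
    · rw [hi, wedge_add_unitVec, hq, h]
      simp [List.range_succ, smul_smul]

/-- The unit rows of `ℝ^m`, in decreasing order. -/
def unitRow (m : ℕ) (j : ℕ) : Fin m → ℝ :=
  fun s => if j + s + 1 = m then 1 else 0

theorem volForm_unitRow (m : ℕ) :
    volForm m (((List.range m).reverse.map fun j => ExteriorAlgebra.ι ℝ (unitRow m j))).prod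
      = 1 := by
  have e : ((List.range m).reverse.map fun j => ExteriorAlgebra.ι ℝ (unitRow m j)) =
      List.ofFn fun i : Fin m => ExteriorAlgebra.ι ℝ (unitRow m (m - 1 - i)) := by
    apply List.ext_getElem
    · simp
    · intro i h1 h2
      simp
  rw [e, volForm_prod]
  convert Matrix.det_one (n := Fin m) (R := ℝ)
  ext i s
  have := i.2
  simp only [Matrix.of_apply, unitRow, Matrix.one_apply, Fin.ext_iff]
  congr 1
  simp only [eq_iff_iff]
  omega

/-! ### Prescribing the minors of basis vectors. -/

/-- Equations are satisfied in decreasing order of `ρ`: a correction along `ε (ρ b)` repairs the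
equation of `b` and is invisible to those with larger `ρ`. -/
theorem exists_of_triangular {α V : Type*} [AddCommGroup V] [Module ℝ V] (K : Finset α)
    (ρ : α → ℕ) (hρ : Set.InjOn ρ K) (φ : α → V →ₗ[ℝ] ℝ) (ε : ℕ → V)
    (hne : ∀ x ∈ K, φ x (ε (ρ x)) ≠ 0) (hz : ∀ x ∈ K, ∀ j < ρ x, φ x (ε j) = 0) (t : α → ℝ) :
    ∃ u, ∀ x ∈ K, φ x u = t x := by
  classical
  induction K using Finset.induction_on_min_value ρ with
  | empty => exact ⟨0, by simp⟩
  | insert b s hb hmin ih =>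
    obtain ⟨u, hu⟩ := ih (hρ.mono (by simp)) (fun x hx => hne x (Finset.mem_insert_of_mem hx))
      (fun x hx => hz x (Finset.mem_insert_of_mem hx))
    refine ⟨u + ((t b - φ b u) / φ b (ε (ρ b))) • ε (ρ b), fun x hx => ?_⟩
    rcases Finset.mem_insert.1 hx with rfl | hxs
    · have := hne x hx
      simp only [map_add, map_smul, smul_eq_mul]
      field_simp
      ring
    · have hlt : ρ b < ρ x := by
        refine lt_of_le_of_ne (hmin x hxs) fun h => hb ?_
        have := hρ (by simp) (by simp [hxs]) h
        rwa [this]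
      simp [hu x hxs, hz x hx _ hlt]

theorem eq_of_offset_add_eq {a : Fin n → ℕ} {q q' : Fin n} {s s' : ℕ} (hs : s < a q)
    (hs' : s' < a q') (h : offset a q + s = offset a q' + s') : q = q' ∧ s = s' := by
  rcases lt_trichotomy q q' with hlt | rfl | hlt
  · have := offset_add_le a hlt; omega
  · exact ⟨rfl, by omega⟩
  · have := offset_add_le a hlt; omega

/-- Supplies the pivot for a basis vector `x` whose last position is `r`: remove that position to
get `y`, and let `q` be the first deficient index. Filling the next position of block `q` gives
another basis vector, one below `r`, whose minor is already prescribed. -/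
theorem exists_last_position {a x : Fin n → ℕ} {m r : ℕ} (hx : x ≤ a) (hm : size x = m)
    (hmr : m ≤ r) (hav : Avoids4 a x) (hb : Below a (r + 1) x) (hnb : ¬ Below a r x) :
    ∃ (y : Fin n → ℕ) (q d : Fin n), x = y + unitVec d ∧ offset a d + y d = r ∧ q < d ∧
      y q < a q ∧ (∀ i < q, y i = a i) ∧ offset a q + y q < m ∧ (∀ i, d < i → x i = 0) ∧
      Below a r y ∧ Below a r (y + unitVec q) ∧ y + unitVec q ≤ a ∧ size (y + unitVec q) = m ∧
      Avoids4 a (y + unitVec q) := by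
  simp only [Below, not_forall, not_le] at hnb
  obtain ⟨d, hd, hdr⟩ := hnb
  have hdr' := hb d hd
  have hafter : ∀ i, d < i → x i = 0 := by
    intro i hi
    by_contra h
    have := hb i h
    have := offset_add_le a hi
    have : x d ≤ a d := hx d
    omega
  -- If all blocks before `d` were full, `x` would contain the first `r + 1 > m` positions.
  obtain ⟨p, hpd, hp⟩ : ∃ p < d, x p < a p := by
    by_contra! hcon
    have : offset a d + x d ≤ size x := by
      have e : offset a d ≤ ∑ i ∈ Finset.Iio d, x i :=
        Finset.sum_le_sum fun i hi => hcon i (Finset.mem_Iio.1 hi)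
      have e2 : ∑ i ∈ insert d (Finset.Iio d), x i ≤ size x :=
        Finset.sum_le_sum_of_subset (Finset.subset_univ _)
      rw [Finset.sum_insert (by simp)] at e2
      omega
    omega
  obtain ⟨q, hqp, hq, hqlt⟩ := exists_first_deficient hp
  have hqd := lt_of_le_of_lt hqp hpd
  obtain ⟨y, rfl⟩ := exists_add_unitVec hd
  have hyd : (y + unitVec d) d = y d + 1 := by simp [unitVec_self]
  have hyne : ∀ i, i ≠ d → (y + unitVec d) i = y i := fun i hi => by simp [unitVec_of_ne hi]
  rw [hyd] at hdr hdr'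
  have hyq := hyne q hqd.ne
  rw [hyq] at hq
  have hby : Below a r y := by
    intro i hi
    rcases lt_trichotomy i d with h | h | h
    · have := offset_add_le a h
      have : (y + unitVec d) i ≤ a i := hx i
      rw [hyne i h.ne] at this
      omega
    · subst h; omega
    · have := hafter i h
      rw [hyne i h.ne'] at this
      exact absurd this hi
  have hs : size y + 1 = m := by rw [← hm, size_add, size_unitVec]
  have hya : y ≤ a := fun i => le_trans (by simp) (hx i)
  have hfull : ∀ i < q, y i = a i := fun i hi => by
    have h1 := hqlt i hi
    rw [hyne i (hi.trans hqd).ne] at h1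
    exact le_antisymm (hya i) h1
  have hzq : (y + unitVec q) q = y q + 1 := by simp [unitVec_self]
  have hzne : ∀ i, i ≠ q → (y + unitVec q) i = y i := fun i hi => by simp [unitVec_of_ne hi]
  refine ⟨y, q, d, rfl, by omega, hqd, hq, hfull, ?_, hafter, hby, ?_, ?_, ?_, ?_⟩
  · have e : offset a q = ∑ i ∈ Finset.Iio q, y i :=
      Finset.sum_congr rfl fun i hi => (hfull i (Finset.mem_Iio.1 hi)).symm
    have e2 : ∑ i ∈ insert q (Finset.Iio q), y i ≤ size y :=
      Finset.sum_le_sum_of_subset (Finset.subset_univ _)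
    rw [Finset.sum_insert (by simp)] at e2
    omega
  · intro i hi
    by_cases h : i = q
    · subst h
      have := offset_add_le a hqd
      omega
    · rw [hzne i h] at hi ⊢
      exact hby i hi
  · intro i
    by_cases h : i = q
    · rw [h, hzq]; exact hq
    · rw [hzne i h]; exact hya i
  · rw [size_add, size_unitVec, hs]
  -- A forbidden pattern of `y + unitVec q` starts at or after `q`, so its other three indices lie
  -- beyond `q`; with `q` as deficient index it would be a pattern of `x`.
  · intro q' i j k h1 h2 h3 hq' hi hk
    have hqq : q ≤ q' := by
      by_contra hc
      have := hfull q' (not_le.1 hc)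
      rw [hzne q' (not_le.1 hc).ne] at hq'
      omega
    have hqi := lt_of_le_of_lt hqq h1
    have hqj := hqi.trans h2
    have hqk := hqj.trans h3
    rw [hzne _ hqi.ne'] at hi
    rw [hzne _ hqk.ne'] at hk
    rw [hzne _ hqj.ne']
    have hkd : k ≤ d := by
      by_contra hc
      have := hafter k (not_le.1 hc)
      rw [hyne k (not_le.1 hc).ne'] at this
      exact hk this
    have := hav q i j k hqi h2 h3 (by rwa [hyq]) (by simp [hi]) (by simp [hk])
    rwa [hyne j (lt_of_lt_of_le h3 hkd).ne] at this

/-- Vectors of equal size that differ have entries with opposite inequalities, here both between `q`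
and `d`. The vector that is larger at the left one of the two has there a nonzero entry followed by
a deficient one, and with `q` and `d` this is a forbidden pattern. -/
theorem eq_of_common_ends {a x x' : Fin n → ℕ} {q d : Fin n} (hx : x ≤ a) (hx' : x' ≤ a)
    (hs : size x = size x') (hav : Avoids4 a x) (hav' : Avoids4 a x') (hq : x q < a q)
    (hd : x d ≠ 0) (hle : ∀ i ≤ q, x i = x' i) (hge : ∀ i, d ≤ i → x i = x' i) : x = x' := by
  by_contra hne
  have hex : ∀ {z z' : Fin n → ℕ}, size z = size z' → z ≠ z' → ∃ i, z i < z' i := by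
    intro z z' h1 h2
    by_contra! h3
    exact h2 (eq_of_le_of_size_eq (x := z') (y := z) h3 h1.symm).symm
  obtain ⟨i, hi⟩ := hex hs hne
  obtain ⟨j, hj⟩ := hex hs.symm (Ne.symm hne)
  have hqi : q < i := by
    by_contra h; exact hi.ne (hle i (not_lt.1 h))
  have hid : i < d := by
    by_contra h; exact hi.ne (hge i (not_lt.1 h))
  have hqj : q < j := by
    by_contra h; exact hj.ne' (hle j (not_lt.1 h))
  have hjd : j < d := by
    by_contra h; exact hj.ne' (hge j (not_lt.1 h))
  have hai : x' i ≤ a i := hx' i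
  have haj : x j ≤ a j := hx j
  rcases lt_trichotomy i j with h | h | h
  · have := hav' q i j d hqi h hjd (by rwa [← hle q le_rfl]) (by omega)
      (by rwa [← hge d le_rfl])
    omega
  · subst h; omega
  · have := hav q j i d hqj h hid hq (by omega) hd
    omega

/-- Induction on the number of rows after the first `m`. The minors whose last position is `r` are
linear in row `r`, and earlier minors do not involve it. -/
theorem exists_rows {a : Fin n → ℕ} {m : ℕ} (hm : m ≤ size a) (C : ℝ) (hC : C ≠ 0)
    (g : (Fin n → ℕ) → ℝ) (hg : ∀ x, g x ≠ 0)
    (hinit : C * volForm m (wedge a (unitRow m) (initVec a m)) = g (initVec a m)) (k : ℕ) :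
    ∃ v : ℕ → Fin m → ℝ, (∀ j < m, v j = unitRow m j) ∧
      ∀ x ≤ a, size x = m → Avoids4 a x → Below a (m + k) x →
        C * volForm m (wedge a v x) = g x := by
  induction k with
  | zero =>
    refine ⟨unitRow m, fun _ _ => rfl, fun x hx hs _ hb => ?_⟩
    rw [eq_initVec_of_below hx hs hb, hinit]
  | succ k ih =>
    obtain ⟨v, hv, hvg⟩ := ih
    rcases isEmpty_or_nonempty (Fin n) with hn | hn
    · exact ⟨v, hv, fun x hx hs hav _ => hvg x hx hs hav fun i => isEmptyElim i⟩
    set r := m + k with hr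
    have hfin : {x | x ≤ a ∧ size x = m ∧ Avoids4 a x ∧ Below a (r + 1) x ∧
        ¬ Below a r x}.Finite := (Set.finite_Iic a).subset fun x hx => hx.1
    set K := hfin.toFinset with hK
    have hdata : ∀ x ∈ K, ∃ (y : Fin n → ℕ) (q d : Fin n), x = y + unitVec d ∧
        offset a d + y d = r ∧ q < d ∧ y q < a q ∧ (∀ i < q, y i = a i) ∧ offset a q + y q < m ∧
        (∀ i, d < i → x i = 0) ∧ Below a r y ∧ Below a r (y + unitVec q) ∧ y + unitVec q ≤ a ∧
        size (y + unitVec q) = m ∧ Avoids4 a (y + unitVec q) := by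
      intro x hx
      simp only [hK, Set.Finite.mem_toFinset, Set.mem_ofPred_eq] at hx
      obtain ⟨h1, h2, h3, h4, h5⟩ := hx
      exact exists_last_position h1 h2 (by omega) h3 h4 h5
    have hKm : ∀ x ∈ K, x ≤ a ∧ size x = m ∧ Avoids4 a x := by
      intro x hx
      simp only [hK, Set.Finite.mem_toFinset, Set.mem_ofPred_eq] at hx
      exact ⟨hx.1, hx.2.1, hx.2.2.1⟩
    choose! y q d hyx hyr hqd hyq hfull hqm hafter hby hbz hza hzs hzav using hdata
    let φ : (Fin n → ℕ) → (Fin m → ℝ) →ₗ[ℝ] ℝ := fun x =>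
      (C * moveSign (y x) (d x)) • (volForm m ∘ₗ LinearMap.mulRight ℝ (wedge a v (y x)) ∘ₗ
        ExteriorAlgebra.ι ℝ)
    have hφ : ∀ x u, φ x u = C * moveSign (y x) (d x) *
      volForm m (ExteriorAlgebra.ι ℝ u * wedge a v (y x)) := fun x u => rfl
    have hsgn : ∀ (z : Fin n → ℕ) i, moveSign z i ≠ 0 := fun z i =>
      left_ne_zero_of_mul_eq_one (moveSign_mul_self z i)
    have hex : ∃ u, ∀ x ∈ K, φ x u = g x := by
      -- The pivot of `x` is the first free position `offset a q + y q`, which is less than `m`, so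
      -- a unit row is attached to it. Pivot and `r` determine `q`, `d` and both entries there,
      -- hence `x` by `eq_of_common_ends`.
      refine exists_of_triangular K (fun x => offset a (q x) + y x (q x)) ?_ φ (unitRow m) ?_ ?_ g
      · intro x hx x' hx' h
        rw [Finset.mem_coe] at hx hx'
        obtain ⟨hqq, hyy⟩ := eq_of_offset_add_eq (hyq x hx) (hyq x' hx') h
        have hlt : ∀ {x}, x ∈ K → y x (d x) < a (d x) := by
          intro x hx
          have h1 : x (d x) ≤ a (d x) := (hKm x hx).1 (d x)
          have h2 := congrFun (hyx x hx) (d x)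
          rw [Pi.add_apply, unitVec_self] at h2
          omega
        obtain ⟨hdd, hydd⟩ := eq_of_offset_add_eq (hlt hx) (hlt hx')
          ((hyr x hx).trans (hyr x' hx').symm)
        have hxy : ∀ {x}, x ∈ K → ∀ i, i ≠ d x → x i = y x i := by
          intro x hx i hi
          have h2 := congrFun (hyx x hx) i
          rwa [Pi.add_apply, unitVec_of_ne hi] at h2
        have hxd : ∀ {x}, x ∈ K → x (d x) = y x (d x) + 1 := by
          intro x hx
          have h2 := congrFun (hyx x hx) (d x)
          rwa [Pi.add_apply, unitVec_self] at h2
        obtain ⟨hxa, hxs, hxav⟩ := hKm x hx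
        obtain ⟨hxa', hxs', hxav'⟩ := hKm x' hx'
        refine eq_of_common_ends (q := q x) (d := d x) hxa hxa' (hxs.trans hxs'.symm) hxav hxav'
          ?_ ?_ ?_ ?_
        · rw [hxy hx _ (hqd x hx).ne]; exact hyq x hx
        · rw [hxd hx]; omega
        · intro i hi
          have hid : i < d x := lt_of_le_of_lt hi (hqd x hx)
          rw [hxy hx i hid.ne, hxy hx' i (hdd ▸ hid.ne)]
          rcases hi.lt_or_eq with h1 | h1
          · rw [hfull x hx i h1, hfull x' hx' i (hqq ▸ h1)]
          · rw [h1, hyy, hqq]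
        · intro i hi
          rcases hi.lt_or_eq with h1 | h1
          · rw [hafter x hx i h1, hafter x' hx' i (hdd ▸ h1)]
          · rw [← h1, hxd hx, hydd, hdd, hxd hx']
      -- Up to sign, the diagonal entry is the minor of `y + unitVec q`, already equal to a nonzero
      -- value of `g`.
      · intro x hx
        have h1 := hvg _ (hza x hx) (hzs x hx) (hzav x hx) (hbz x hx)
        rw [wedge_add_unitVec, hv _ (hqm x hx), map_smul, smul_eq_mul] at h1
        have h2 := hg (y x + unitVec (q x))
        rw [← h1] at h2
        rw [hφ]
        exact mul_ne_zero (mul_ne_zero hC (hsgn _ _))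
          (right_ne_zero_of_mul (right_ne_zero_of_mul h2))
      -- Every position before the pivot belongs to `y`, so its unit row would occur twice.
      · intro x hx j hj
        have hqm' := hqm x hx
        obtain ⟨p, hp1, hp2⟩ := exists_block (a := a) (p := j) (by omega)
        have hmem : unitRow m j ∈ rowList a v (y x) := by
          rw [mem_rowList]
          refine ⟨p, j - offset a p, ?_, ?_⟩
          · rcases lt_trichotomy p (q x) with h | h | h
            · rw [hfull x hx p h]; omega
            · subst h; omega
            · have h1 := offset_add_le a h
              have h2 := hyq x hx
              omega
          · rw [Nat.add_sub_cancel' hp1, hv j (by omega)]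
        rw [hφ]
        have := ι_mul_prod_eq_zero hmem
        rw [wedge, this, map_zero, mul_zero]
    obtain ⟨u, hu⟩ := hex
    have hcongr : ∀ x, Below a r x → wedge a (Function.update v r u) x = wedge a v x := by
      intro x hx
      unfold wedge
      rw [rowList_congr]
      intro i e he
      have := hx i (by omega)
      rw [Function.update_of_ne (by omega)]
    refine ⟨Function.update v r u, fun j hj => ?_, fun x hx hs hav hb => ?_⟩
    · rw [Function.update_of_ne (by omega), hv j hj]
    · by_cases hbr : Below a r x
      · rw [hcongr x hbr]
        exact hvg x hx hs hav hbr
      · have hxK : x ∈ K := by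
          simp only [hK, Set.Finite.mem_toFinset, Set.mem_ofPred_eq]
          exact ⟨hx, hs, hav, hb, hbr⟩
        rw [← hu x hxK, hφ]
        conv_lhs => rw [hyx x hxK]
        rw [wedge_add_unitVec, hcongr _ (hby x hxK), hyr x hxK, Function.update_self, map_smul,
          smul_eq_mul, mul_assoc]

theorem exists_isPlucker {a : Fin n → ℕ} {m : ℕ} (hm : m ≤ size a)
    (g : (Fin n → ℕ) → ℝ) (hg : ∀ x, g x ≠ 0) :
    ∃ P, IsPlucker a m P ∧ ∀ x ≤ a, size x = m → Avoids4 a x → P x = g x := by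
  have hne : volForm m (wedge a (unitRow m) (initVec a m)) ≠ 0 := by
    obtain ⟨s, hs, h⟩ := wedge_initVec a (unitRow m) hm
    rw [h, map_smul, volForm_unitRow]
    simpa using hs
  -- The first `m` rows are fixed, so the minor of the initial vector cannot be adjusted by them;
  -- the scalar `C` corrects it.
  obtain ⟨v, -, hv⟩ := exists_rows hm (g (initVec a m) / _) (div_ne_zero (hg _) hne) g hg
    (div_mul_cancel₀ _ hne) (size a)
  refine ⟨_, isPlucker_volForm a m v _, fun x hx hs hav => hv x hx hs hav fun i hi => ?_⟩
  have h1 : offset a i + a i ≤ size a := by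
    rw [offset, add_comm, ← Finset.sum_insert (by simp)]
    exact Finset.sum_le_sum_of_subset (Finset.subset_univ _)
  have h2 : x i ≤ a i := hx i
  omega

/-! ### Passage from Plücker functions to tropical ones. -/

open Filter Topology

/-- The TP4-relations on the vectors of size `m` in the box `B(a)`. -/
def IsTropicalPlucker (a : Fin n → ℕ) (m : ℕ) (f : (Fin n → ℕ) → ℝ) : Prop :=
  ∀ (X : Fin n → ℕ) (i j k l : Fin n), i < j → j < k → k < l →
    X + unitVec i + unitVec j + unitVec k + unitVec l ≤ a → size X + 2 = m →
    f (X + unitVec i + unitVec k) + f (X + unitVec j + unitVec l) =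
      max (f (X + unitVec i + unitVec j) + f (X + unitVec k + unitVec l))
        (f (X + unitVec i + unitVec l) + f (X + unitVec j + unitVec k))

theorem add_add_le_of_le {a X : Fin n → ℕ} {i j k l : Fin n}
    (h : X + unitVec i + unitVec j + unitVec k + unitVec l ≤ a) :
    X + unitVec i + unitVec k ≤ a ∧ X + unitVec j + unitVec l ≤ a ∧
      X + unitVec i + unitVec j ≤ a ∧ X + unitVec k + unitVec l ≤ a ∧
      X + unitVec i + unitVec l ≤ a ∧ X + unitVec j + unitVec k ≤ a := by
  refine ⟨?_, ?_, ?_, ?_, ?_, ?_⟩ <;>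
  · intro p
    have := h p
    simp only [Pi.add_apply] at this ⊢
    omega

theorem size_add_add (X : Fin n → ℕ) (i j : Fin n) :
    size (X + unitVec i + unitVec j) = size X + 2 := by
  simp [size_add, size_unitVec]

/-- Induction over the vectors of size `m` in a box along exchange relations. -/
theorem exchange_induction {a : Fin n → ℕ} {m : ℕ} {p : (Fin n → ℕ) → Prop}
    (base : ∀ x ≤ a, size x = m → Avoids4 a x → p x)
    (step : ∀ (X : Fin n → ℕ) (i j k l : Fin n), i < j → j < k → k < l →
      X + unitVec i + unitVec j + unitVec k + unitVec l ≤ a → size X + 2 = m →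
      p (X + unitVec i + unitVec k) → p (X + unitVec i + unitVec j) →
      p (X + unitVec k + unitVec l) → p (X + unitVec i + unitVec l) →
      p (X + unitVec j + unitVec k) → p (X + unitVec j + unitVec l)) :
    ∀ x ≤ a, size x = m → p x := by
  intro x
  induction x using (InvImage.wf (rank a) wellFounded_lt).induction with
  | _ x ih =>
    intro hx hs
    by_cases hav : Avoids4 a x
    · exact base x hx hs hav
    · obtain ⟨X, i, j, k, l, hij, hjk, hkl, hle, rfl, h1, h2, h3, h4, h5⟩ :=
        exists_exchange hx hav
      obtain ⟨l1, l2, l3, l4, l5, l6⟩ := add_add_le_of_le hle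
      rw [size_add_add] at hs
      exact step X i j k l hij hjk hkl hle hs
        (ih _ h1 l1 (by rw [size_add_add, hs])) (ih _ h2 l3 (by rw [size_add_add, hs]))
        (ih _ h3 l4 (by rw [size_add_add, hs])) (ih _ h4 l5 (by rw [size_add_add, hs]))
        (ih _ h5 l6 (by rw [size_add_add, hs]))

theorem IsTropicalPlucker.eq_of_eq_on_basis {a : Fin n → ℕ} {m : ℕ} {f g : (Fin n → ℕ) → ℝ}
    (hf : IsTropicalPlucker a m f) (hg : IsTropicalPlucker a m g)
    (h : ∀ x ≤ a, size x = m → Avoids4 a x → f x = g x) : ∀ x ≤ a, size x = m → f x = g x := by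
  refine exchange_induction h ?_
  intro X i j k l hij hjk hkl hle hs h1 h2 h3 h4 h5
  have e1 := hf X i j k l hij hjk hkl hle hs
  have e2 := hg X i j k l hij hjk hkl hle hs
  rw [h1, h2, h3, h4, h5, ← e2] at e1
  linarith

/-- The sum lies between the larger term and twice it, and `log 2 / (k + 1)` tends to zero. -/
theorem tendsto_log_add {A B : ℕ → ℝ} {α β : ℝ} (hA : ∀ k, 0 < A k) (hB : ∀ k, 0 < B k)
    (hα : Tendsto (fun k : ℕ => Real.log (A k) / (k + 1)) atTop (𝓝 α))
    (hβ : Tendsto (fun k : ℕ => Real.log (B k) / (k + 1)) atTop (𝓝 β)) :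
    Tendsto (fun k : ℕ => Real.log (A k + B k) / (k + 1)) atTop (𝓝 (max α β)) := by
  have h0 : Tendsto (fun k : ℕ => Real.log 2 / ((k : ℝ) + 1)) atTop (𝓝 0) := by
    have := (tendsto_one_div_add_atTop_nhds_zero_nat (𝕜 := ℝ)).const_mul (Real.log 2)
    simpa [div_eq_mul_inv] using this
  have hmax := hα.max hβ
  have hup := hmax.add h0
  rw [add_zero] at hup
  refine tendsto_of_tendsto_of_tendsto_of_le_of_le hmax hup (fun k => ?_) (fun k => ?_)
  · have hk : (0 : ℝ) < k + 1 := by positivity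
    have := hA k
    have := hB k
    refine max_le ?_ ?_
    · exact div_le_div_of_nonneg_right (Real.log_le_log (hA k) (by linarith)) hk.le
    · exact div_le_div_of_nonneg_right (Real.log_le_log (hB k) (by linarith)) hk.le
  · have hk : (0 : ℝ) < k + 1 := by positivity
    have key : ∀ {u w : ℝ}, 0 < u → 0 < w → u ≤ w →
        Real.log (u + w) ≤ Real.log w + Real.log 2 := by
      intro u w hu hw h
      rw [← Real.log_mul hw.ne' two_ne_zero]
      exact Real.log_le_log (by linarith) (by linarith)
    dsimp only
    rcases le_total (A k) (B k) with h | h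
    · have h1 := div_le_div_of_nonneg_right (key (hA k) (hB k) h) hk.le
      rw [add_div] at h1
      exact h1.trans (by gcongr; exact le_max_right _ _)
    · have h1 := div_le_div_of_nonneg_right (key (hB k) (hA k) h) hk.le
      rw [add_div, add_comm (B k)] at h1
      exact h1.trans (by gcongr; exact le_max_left _ _)

theorem tendsto_log_mul {A B : ℕ → ℝ} {α β : ℝ} (hA : ∀ k, 0 < A k) (hB : ∀ k, 0 < B k)
    (hα : Tendsto (fun k : ℕ => Real.log (A k) / (k + 1)) atTop (𝓝 α))
    (hβ : Tendsto (fun k : ℕ => Real.log (B k) / (k + 1)) atTop (𝓝 β)) :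
    Tendsto (fun k : ℕ => Real.log (A k * B k) / (k + 1)) atTop (𝓝 (α + β)) := by
  refine (hα.add hβ).congr fun k => ?_
  rw [Real.log_mul (hA k).ne' (hB k).ne', add_div]

theorem exists_isTropicalPlucker {a : Fin n → ℕ} {m : ℕ} (hm : m ≤ size a)
    (g : (Fin n → ℕ) → ℝ) :
    ∃ f, IsTropicalPlucker a m f ∧ ∀ x ≤ a, size x = m → Avoids4 a x → f x = g x := by
  choose P hP hPg using fun k : ℕ =>
    exists_isPlucker hm (fun x => Real.exp ((k + 1) * g x)) fun x => (Real.exp_pos _).ne'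
  have hlim : ∀ x ≤ a, size x = m → Avoids4 a x →
      Tendsto (fun k : ℕ => Real.log (P k x) / (k + 1)) atTop (𝓝 (g x)) := by
    intro x hx hs hav
    refine tendsto_const_nhds.congr fun k => ?_
    have hk : (k : ℝ) + 1 ≠ 0 := by positivity
    rw [hPg k x hx hs hav, Real.log_exp]
    field_simp
  -- Positivity and convergence are carried together: positivity of five minors gives that of the
  -- sixth, and this allows the relation to be solved for its logarithm.
  have key : ∀ x ≤ a, size x = m → (∀ k, 0 < P k x) ∧
      ∃ L, Tendsto (fun k : ℕ => Real.log (P k x) / (k + 1)) atTop (𝓝 L) := by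
    refine exchange_induction ?_ ?_
    · intro x hx hs hav
      exact ⟨fun k => by rw [hPg k x hx hs hav]; exact Real.exp_pos _, g x, hlim x hx hs hav⟩
    · rintro X i j k l hij hjk hkl hle hs ⟨p1, L1, h1⟩ ⟨p2, L2, h2⟩ ⟨p3, L3, h3⟩ ⟨p4, L4, h4⟩
        ⟨p5, L5, h5⟩
      have e := fun t => hP t X i j k l hij hjk hkl hle hs
      have hpos : ∀ t, 0 < P t (X + unitVec j + unitVec l) := by
        intro t
        have h6 : 0 < P t (X + unitVec i + unitVec k) * P t (X + unitVec j + unitVec l) := by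
          rw [e t]
          exact add_pos (mul_pos (p2 t) (p3 t)) (mul_pos (p4 t) (p5 t))
        exact (pos_iff_pos_of_mul_pos h6).1 (p1 t)
      refine ⟨hpos, max (L2 + L3) (L4 + L5) - L1, ?_⟩
      have h6 := tendsto_log_add (fun t => mul_pos (p2 t) (p3 t)) (fun t => mul_pos (p4 t) (p5 t))
        (tendsto_log_mul p2 p3 h2 h3) (tendsto_log_mul p4 p5 h4 h5)
      refine (h6.sub h1).congr fun t => ?_
      rw [← e t, Real.log_mul (p1 t).ne' (hpos t).ne']
      ring
  choose! hpos L hL using key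
  refine ⟨L, ?_, fun x hx hs hav => tendsto_nhds_unique (hL x hx hs) (hlim x hx hs hav)⟩
  intro X i j k l hij hjk hkl hle hs
  obtain ⟨l1, l2, l3, l4, l5, l6⟩ := add_add_le_of_le hle
  have hsz : ∀ p q, size (X + unitVec p + unitVec q) = m := fun p q => by rw [size_add_add, hs]
  have hl := tendsto_log_mul (hpos _ l1 (hsz _ _)) (hpos _ l2 (hsz _ _)) (hL _ l1 (hsz _ _))
    (hL _ l2 (hsz _ _))
  have h3 := tendsto_log_mul (hpos _ l3 (hsz _ _)) (hpos _ l4 (hsz _ _)) (hL _ l3 (hsz _ _))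
    (hL _ l4 (hsz _ _))
  have h5 := tendsto_log_mul (hpos _ l5 (hsz _ _)) (hpos _ l6 (hsz _ _)) (hL _ l5 (hsz _ _))
    (hL _ l6 (hsz _ _))
  have hr := tendsto_log_add
    (fun t => mul_pos (hpos _ l3 (hsz _ _) t) (hpos _ l4 (hsz _ _) t))
    (fun t => mul_pos (hpos _ l5 (hsz _ _) t) (hpos _ l6 (hsz _ _) t)) h3 h5
  refine tendsto_nhds_unique hl (hr.congr fun t => ?_)
  rw [hP t X i j k l hij hjk hkl hle hs]

/-! ### Fints and sints as pattern-avoiding vectors. -/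

theorem exists_isGreatest_support {x : Fin n → ℕ} (h : x ≠ 0) :
    ∃ d, IsGreatest (Function.support x) d := by
  obtain ⟨p, hp⟩ := Function.ne_iff.1 h
  obtain ⟨d, hd, hdmax⟩ := WellFounded.has_min (wellFounded_gt (α := Fin n))
    (Function.support x) ⟨p, hp⟩
  exact ⟨d, hd, fun i hi => not_lt.1 (hdmax i hi)⟩

theorem exists_isLeast_support {x : Fin n → ℕ} (h : x ≠ 0) :
    ∃ c, IsLeast (Function.support x) c := by
  obtain ⟨p, hp⟩ := Function.ne_iff.1 h
  obtain ⟨c, hc, hcmin⟩ := WellFounded.has_min (wellFounded_lt (α := Fin n))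
    (Function.support x) ⟨p, hp⟩
  exact ⟨c, hc, fun i hi => not_lt.1 (hcmin i hi)⟩

theorem isFint_iff {a x : Fin n → ℕ} : IsFint a x ↔ x ≤ a ∧ x ≠ 0 ∧ Avoids3 a x := by
  constructor
  · rintro ⟨hx, c, d, hc, hd, h⟩
    refine ⟨hx, fun h0 => ?_, fun i j k hij hjk hi hk => ?_⟩
    · subst h0
      exact hc.1 rfl
    · exact (h j (lt_of_le_of_lt (hc.2 hi) hij) (lt_of_lt_of_le hjk (hd.2 hk))).ge
  · rintro ⟨hx, h0, hav⟩
    obtain ⟨c, hc⟩ := exists_isLeast_support h0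
    obtain ⟨d, hd⟩ := exists_isGreatest_support h0
    exact ⟨hx, c, d, hc, hd, fun i h1 h2 => le_antisymm (hx i) (hav c i d h1 h2 hc.1 hd.1)⟩

theorem Avoids3.avoids4 {a x : Fin n → ℕ} (h : Avoids3 a x) : Avoids4 a x :=
  fun _ i j k _ hij hjk _ hi hk => h i j k hij hjk hi hk

/-- A deficient index cannot precede `d'`, so the rest of a pattern lies beyond `d'`, where the
vector coincides with the fint `x''`. -/
theorem IsSint.avoids4 {a x : Fin n → ℕ} (h : IsSint a x) : Avoids4 a x := by
  obtain ⟨hx, -, x', x'', -, h2, rfl, d', c'', hd', hc'', hlt, hfull⟩ := h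
  obtain ⟨-, -, hav⟩ := isFint_iff.1 h2
  intro p i j k hpi hij hjk hp hi hk
  have hdp : d' ≤ p := by
    by_contra hc
    have := hfull p (not_le.1 hc)
    simp only [Pi.add_apply] at hp
    omega
  have hzero : ∀ i, d' < i → x' i = 0 := by
    intro i hi
    by_contra hc
    exact absurd (hd'.2 hc) (not_le.2 hi)
  have hdi := lt_of_le_of_lt hdp hpi
  have h1 := hzero i hdi
  have h3 := hzero k (hdi.trans (hij.trans hjk))
  simp only [Pi.add_apply] at hi hk ⊢
  have := hav i j k hij hjk (by omega) (by omega)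
  omega

theorem isSint_of_avoids4 {a x : Fin n → ℕ} (hx : x ≤ a) (hav : Avoids4 a x) (h0 : x ≠ 0)
    (hf : ¬ IsFint a x) : IsSint a x := by
  have h3 : ¬ Avoids3 a x := fun h => hf (isFint_iff.2 ⟨hx, h0, h⟩)
  obtain ⟨p, hp⟩ : ∃ p, x p < a p := by
    by_contra! hc
    exact h3 fun _ j _ _ _ _ _ => hc j
  -- Cut after the first deficient index `q`. The left part is full before `q`; the right part
  -- avoids the three-term pattern because `q` serves as deficient index. Were either part zero, `x`
  -- would be a fint.
  obtain ⟨q, -, hq, hqlt⟩ := exists_first_deficient hp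
  let y : Fin n → ℕ := fun i => if i ≤ q then x i else 0
  let z : Fin n → ℕ := fun i => if i ≤ q then 0 else x i
  have hyz : x = y + z := by
    funext i
    simp only [y, z, Pi.add_apply]
    split_ifs <;> simp
  have hya : y ≤ a := by
    intro i
    simp only [y]
    split_ifs
    · exact hx i
    · exact Nat.zero_le _
  have hza : z ≤ a := by
    intro i
    simp only [z]
    split_ifs
    · exact Nat.zero_le _
    · exact hx i
  have hyq : ∀ i, y i ≠ 0 → i ≤ q := by
    intro i hi
    by_contra hc
    simp [y, hc] at hi
  have hzq : ∀ i, z i ≠ 0 → q < i := by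
    intro i hi
    by_contra hc
    simp [z, not_lt.1 hc] at hi
  have hyav : Avoids3 a y := by
    intro i j k hij hjk hi hk
    have hjq : j < q := lt_of_lt_of_le hjk (hyq k hk)
    have := hqlt j hjq
    simpa [y, hjq.le] using this
  have hzav : Avoids3 a z := by
    intro i j k hij hjk hi hk
    have hqi := hzq i hi
    have hqj := hqi.trans hij
    have hqk := hqj.trans hjk
    simp only [z, not_le.2 hqi, not_le.2 hqj, not_le.2 hqk, if_false] at hi hk ⊢
    exact hav q i j k hqi hij hjk hq hi hk
  have hy0 : y ≠ 0 := by
    intro h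
    rw [h, zero_add] at hyz
    exact h3 (hyz ▸ hzav)
  have hz0 : z ≠ 0 := by
    intro h
    rw [h, add_zero] at hyz
    exact h3 (hyz ▸ hyav)
  obtain ⟨d, hd⟩ := exists_isGreatest_support hy0
  obtain ⟨c, hc⟩ := exists_isLeast_support hz0
  have hdq := hyq d hd.1
  refine ⟨hx, hf, y, z, isFint_iff.2 ⟨hya, hy0, hyav⟩, isFint_iff.2 ⟨hza, hz0, hzav⟩, hyz, d, c,
    hd, hc, lt_of_le_of_lt hdq (hzq c hc.1), fun i hi => ?_⟩
  have hiq := lt_of_lt_of_le hi hdq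
  have := hqlt i hiq
  refine le_antisymm (hya i) ?_
  simpa [y, hiq.le] using this

/-! ### Reduction of a truncated box to one layer. -/

/-- Completion of a vector to size `M` by a new first coordinate. -/
def homogenize (M : ℕ) (x : Fin n → ℕ) : Fin (n + 1) → ℕ := Fin.cons (M - size x) x

/-- The box whose vectors of size `m'` are the completed vectors of `B_m^{m'}(a)`. -/
def capBox (a : Fin n → ℕ) (m m' : ℕ) : Fin (n + 1) → ℕ := Fin.cons (m' - m) a

theorem size_cons (t : ℕ) (x : Fin n → ℕ) :
    size (Fin.cons t x : Fin (n + 1) → ℕ) = t + size x := by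
  simp [size, Fin.sum_univ_succ]

theorem cons_le_cons_iff {s t : ℕ} {x y : Fin n → ℕ} :
    (Fin.cons s x : Fin (n + 1) → ℕ) ≤ Fin.cons t y ↔ s ≤ t ∧ x ≤ y := by
  simp [Pi.le_def, Fin.forall_fin_succ]

theorem unitVec_zero_eq : unitVec (0 : Fin (n + 1)) = Fin.cons 1 0 := by
  funext i
  refine Fin.cases ?_ (fun i => ?_) i <;> simp [unitVec_apply]

theorem unitVec_succ_eq (i : Fin n) : unitVec i.succ = Fin.cons 0 (unitVec i) := by
  funext j
  refine Fin.cases ?_ (fun j => ?_) j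
  · simp [unitVec_apply, (Fin.succ_ne_zero i).symm]
  · simp [unitVec_apply]

theorem cons_add_cons (s t : ℕ) (x y : Fin n → ℕ) :
    (Fin.cons s x + Fin.cons t y : Fin (n + 1) → ℕ) = Fin.cons (s + t) (x + y) := by
  funext i
  refine Fin.cases ?_ (fun i => ?_) i <;> simp

theorem homogenize_le_iff {a x : Fin n → ℕ} {m m' : ℕ} (h : m ≤ m') (hx : size x ≤ m') :
    homogenize m' x ≤ capBox a m m' ↔ x ∈ truncBox a m m' := by
  rw [homogenize, capBox, cons_le_cons_iff]
  simp only [truncBox, Set.mem_ofPred_eq]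
  constructor
  · rintro ⟨h1, h2⟩
    exact ⟨h2, by omega, hx⟩
  · rintro ⟨h1, h2, h3⟩
    exact ⟨by omega, h1⟩

theorem avoids4_homogenize_iff {a x : Fin n → ℕ} {m m' : ℕ} (hx : x ∈ truncBox a m m') :
    Avoids4 (capBox a m m') (homogenize m' x) ↔ x ∈ standardBasis a m m' := by
  obtain ⟨hxa, hm, hm'⟩ := hx
  -- The new coordinate can only be the deficient index of a pattern, and it is deficient exactly
  -- when `m < size x`. This is why sints enter the basis only at size `m`.
  have h1 : Avoids4 (capBox a m m') (homogenize m' x) ↔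
      Avoids4 a x ∧ (m < size x → Avoids3 a x) := by
    constructor
    · intro h
      refine ⟨fun q i j k h1 h2 h3 => ?_, fun hlt i j k h2 h3 => ?_⟩
      · simpa [homogenize, capBox] using
          h q.succ i.succ j.succ k.succ (by simpa) (by simpa) (by simpa)
      · have := h 0 i.succ j.succ k.succ (Fin.succ_pos _) (by simpa) (by simpa)
        simp only [homogenize, capBox, Fin.cons_zero, Fin.cons_succ] at this
        exact this (by omega)
    · rintro ⟨h4, h3⟩ q i j k hqi hij hjk
      obtain ⟨i, rfl⟩ := Fin.exists_succ_eq.2 (Fin.ne_zero_of_lt hqi)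
      obtain ⟨j, rfl⟩ := Fin.exists_succ_eq.2 (Fin.ne_zero_of_lt hij)
      obtain ⟨k, rfl⟩ := Fin.exists_succ_eq.2 (Fin.ne_zero_of_lt hjk)
      rw [Fin.succ_lt_succ_iff] at hij hjk
      simp only [homogenize, capBox, Fin.cons_succ]
      refine Fin.cases (fun _ => ?_) (fun q hqi => ?_) q hqi
      · intro hlt
        simp only [Fin.cons_zero] at hlt
        exact h3 (by omega) i j k hij hjk
      · rw [Fin.succ_lt_succ_iff] at hqi
        simpa using h4 q i j k hqi hij hjk
  rw [h1]
  simp only [standardBasis, sints, fints, Set.mem_union, Set.mem_ofPred_eq, Set.mem_iUnion,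
    Set.mem_Icc, exists_prop]
  constructor
  · rintro ⟨h4, h3⟩
    by_cases h0 : x = 0
    · right
      subst h0
      simp only [size, Pi.zero_apply, Finset.sum_const_zero] at hm
      exact ⟨by omega, rfl⟩
    · by_cases hf : IsFint a x
      · exact Or.inl (Or.inr ⟨size x, ⟨hm, hm'⟩, hf, rfl⟩)
      · refine Or.inl (Or.inl ⟨isSint_of_avoids4 hxa h4 h0 hf, le_antisymm ?_ hm⟩)
        by_contra hc
        exact hf (isFint_iff.2 ⟨hxa, h0, h3 (not_le.1 hc)⟩)
  · rintro ((⟨hs, rfl⟩ | ⟨p, -, hf, -⟩) | ⟨-, rfl⟩)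
    · exact ⟨hs.avoids4, fun h => absurd h (lt_irrefl _)⟩
    · have := (isFint_iff.1 hf).2.2
      exact ⟨this.avoids4, fun _ => this⟩
    · have : Avoids3 a 0 := fun i j k _ _ hi => absurd rfl hi
      exact ⟨this.avoids4, fun _ => this⟩

theorem standardBasis_subset {a : Fin n → ℕ} {m m' : ℕ} (h : m ≤ m') :
    standardBasis a m m' ⊆ truncBox a m m' := by
  rintro x ((⟨hs, rfl⟩ | hf) | ⟨rfl, rfl⟩)
  · exact ⟨hs.1, le_rfl, h⟩
  · simp only [fints, Set.mem_iUnion, Set.mem_ofPred_eq, Set.mem_Icc, exists_prop] at hf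
    obtain ⟨p, hp, hf, rfl⟩ := hf
    exact ⟨hf.1, hp⟩
  · exact ⟨fun i => Nat.zero_le _, Nat.zero_le _, by simp [size]⟩

open Classical in
/-- Extension of a function on a truncated box to the completed vectors. -/
noncomputable def extendCap {a : Fin n → ℕ} {m m' : ℕ} (f : truncBox a m m' → ℝ)
    (z : Fin (n + 1) → ℕ) : ℝ :=
  if h : Fin.tail z ∈ truncBox a m m' then f ⟨_, h⟩ else 0

theorem extendCap_cons {a : Fin n → ℕ} {m m' : ℕ} (f : truncBox a m m' → ℝ) (t : ℕ)
    {x : Fin n → ℕ} (hx : x ∈ truncBox a m m') : extendCap f (Fin.cons t x) = f ⟨x, hx⟩ := by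
  exact dif_pos (c := Fin.tail (Fin.cons t x : Fin (n + 1) → ℕ) ∈ truncBox a m m') hx

theorem isTropicalPlucker_extendCap {a : Fin n → ℕ} {m m' : ℕ} (hmm : m ≤ m')
    {f : truncBox a m m' → ℝ} (hf : f ∈ tpFunctions a m m') :
    IsTropicalPlucker (capBox a m m') m' (extendCap f) := by
  intro Z i j k l hij hjk hkl hle hs
  obtain ⟨j, rfl⟩ := Fin.exists_succ_eq.2 (Fin.ne_zero_of_lt hij)
  obtain ⟨k, rfl⟩ := Fin.exists_succ_eq.2 (Fin.ne_zero_of_lt hjk)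
  obtain ⟨l, rfl⟩ := Fin.exists_succ_eq.2 (Fin.ne_zero_of_lt hkl)
  rw [Fin.succ_lt_succ_iff] at hjk hkl
  obtain ⟨t, X, rfl⟩ : ∃ t X, Z = Fin.cons t X := ⟨Z 0, Fin.tail Z, (Fin.cons_self_tail Z).symm⟩
  rw [size_cons] at hs
  obtain ⟨l1, l2, l3, l4, l5, l6⟩ := add_add_le_of_le hle
  revert l1 l2 l3 l4 l5 l6 hle
  refine Fin.cases (fun _ => ?_) (fun i hij => ?_) i hij
  · simp only [unitVec_zero_eq, unitVec_succ_eq, cons_add_cons, capBox, cons_le_cons_iff,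
      add_zero]
    intro _ l1 l2 l3 l4 l5 l6
    have b1 : X + unitVec k ∈ truncBox a m m' :=
      ⟨l1.2, by rw [size_add, size_unitVec]; omega, by rw [size_add, size_unitVec]; omega⟩
    have b2 : X + unitVec j + unitVec l ∈ truncBox a m m' :=
      ⟨l2.2, by rw [size_add_add]; omega, by rw [size_add_add]; omega⟩
    have b3 : X + unitVec j ∈ truncBox a m m' :=
      ⟨l3.2, by rw [size_add, size_unitVec]; omega, by rw [size_add, size_unitVec]; omega⟩
    have b4 : X + unitVec k + unitVec l ∈ truncBox a m m' :=
      ⟨l4.2, by rw [size_add_add]; omega, by rw [size_add_add]; omega⟩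
    have b5 : X + unitVec l ∈ truncBox a m m' :=
      ⟨l5.2, by rw [size_add, size_unitVec]; omega, by rw [size_add, size_unitVec]; omega⟩
    have b6 : X + unitVec j + unitVec k ∈ truncBox a m m' :=
      ⟨l6.2, by rw [size_add_add]; omega, by rw [size_add_add]; omega⟩
    have h := hf.1 X j k l hjk hkl b2 b1 b6 b5 b3 b4
    rw [extendCap_cons f _ b1, extendCap_cons f _ b2, extendCap_cons f _ b3,
      extendCap_cons f _ b4, extendCap_cons f _ b5, extendCap_cons f _ b6, add_comm, h, max_comm,
      add_comm (f ⟨_, b5⟩)]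
  · rw [Fin.succ_lt_succ_iff] at hij
    simp only [unitVec_succ_eq, cons_add_cons, capBox, cons_le_cons_iff, add_zero]
    intro _ l1 l2 l3 l4 l5 l6
    have b : ∀ p q, X + unitVec p + unitVec q ≤ a → X + unitVec p + unitVec q ∈ truncBox a m m' :=
      fun p q h => ⟨h, by rw [size_add_add]; omega, by rw [size_add_add]; omega⟩
    have h := hf.2 X i j k l hij hjk hkl (b _ _ l1.2) (b _ _ l2.2) (b _ _ l3.2) (b _ _ l4.2)
      (b _ _ l5.2) (b _ _ l6.2)
    rw [extendCap_cons f _ (b _ _ l1.2), extendCap_cons f _ (b _ _ l2.2),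
      extendCap_cons f _ (b _ _ l3.2), extendCap_cons f _ (b _ _ l4.2),
      extendCap_cons f _ (b _ _ l5.2), extendCap_cons f _ (b _ _ l6.2), h]

theorem mem_tpFunctions_of_isTropicalPlucker {a : Fin n → ℕ} {m m' : ℕ} (hmm : m ≤ m')
    {F : (Fin (n + 1) → ℕ) → ℝ} (hF : IsTropicalPlucker (capBox a m m') m' F) :
    (fun x : truncBox a m m' => F (homogenize m' x.1)) ∈ tpFunctions a m m' := by
  constructor
  · intro X i j k hij hjk hik hj hij' hk hi hjk'
    have s1 : size (X + unitVec i + unitVec k) = size X + 2 := size_add_add _ _ _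
    have s2 : ∀ i, size (X + unitVec i) = size X + 1 := fun i => by rw [size_add, size_unitVec]
    have hle1 := hik.1
    have hle2 := hjk'.1
    have hle3 := hij'.1
    have hb := hik.2
    have hbi := hi.2
    rw [s1] at hb
    rw [s2] at hbi
    -- The indices are distinct, so bounds on the pairwise sums give the bound on the full sum
    -- coordinate by coordinate.
    have hall : X + unitVec i + unitVec j + unitVec k ≤ a := by
      intro p
      have h1 := hle1 p
      have h2 := hle2 p
      have h3 := hle3 p
      simp only [Pi.add_apply, unitVec_apply] at h1 h2 h3 ⊢
      have := hij.ne
      have := hjk.ne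
      have := (hij.trans hjk).ne
      split_ifs at h1 h2 h3 ⊢ <;> subst_vars <;> omega
    have h := hF (Fin.cons (m' - (size X + 2)) X) 0 i.succ j.succ k.succ (Fin.succ_pos _)
      (by simpa) (by simpa)
      (by
        simp only [unitVec_zero_eq, unitVec_succ_eq, cons_add_cons, capBox, cons_le_cons_iff,
          add_zero]
        exact ⟨by omega, hall⟩)
      (by rw [size_cons]; omega)
    simp only [unitVec_zero_eq, unitVec_succ_eq, cons_add_cons, add_zero] at h
    simp only [homogenize, size_add_add, s2]
    have e : m' - (size X + 2) + 1 = m' - (size X + 1) := by omega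
    rw [e] at h
    rw [add_comm, h, max_comm, add_comm (F (Fin.cons _ (X + unitVec k)))]
  · intro X i j k l hij hjk hkl hik hjl hij' hkl' hil hjk'
    have hle1 := hik.1
    have hle2 := hjl.1
    have hb := hik.2
    rw [size_add_add] at hb
    have hall : X + unitVec i + unitVec j + unitVec k + unitVec l ≤ a := by
      intro p
      have h1 := hle1 p
      have h2 := hle2 p
      have h3 := hij'.1 p
      have h4 := hkl'.1 p
      have h5 := hil.1 p
      have h6 := hjk'.1 p
      simp only [Pi.add_apply, unitVec_apply] at h1 h2 h3 h4 h5 h6 ⊢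
      have := hij.ne
      have := hjk.ne
      have := hkl.ne
      have := (hij.trans hjk).ne
      have := (hjk.trans hkl).ne
      have := (hij.trans (hjk.trans hkl)).ne
      split_ifs at h1 h2 h3 h4 h5 h6 ⊢ <;> subst_vars <;> omega
    have h := hF (Fin.cons (m' - (size X + 2)) X) i.succ j.succ k.succ l.succ
      (by simpa) (by simpa) (by simpa)
      (by
        simp only [unitVec_succ_eq, cons_add_cons, capBox, cons_le_cons_iff, add_zero]
        exact ⟨by omega, hall⟩)
      (by rw [size_cons]; omega)
    simp only [unitVec_succ_eq, cons_add_cons, add_zero] at h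
    simpa only [homogenize, size_add_add] using h

theorem mem_truncBox_of_le_capBox {a : Fin n → ℕ} {m m' : ℕ} (hmm : m ≤ m')
    {z : Fin (n + 1) → ℕ} (hz : z ≤ capBox a m m') (hs : size z = m') :
    z = homogenize m' (Fin.tail z) ∧ Fin.tail z ∈ truncBox a m m' := by
  obtain ⟨t, x, rfl⟩ : ∃ t x, z = Fin.cons t x := ⟨z 0, Fin.tail z, (Fin.cons_self_tail z).symm⟩
  rw [size_cons] at hs
  have h : (Fin.cons t x : Fin (n + 1) → ℕ) = homogenize m' x := by
    rw [homogenize]; congr 1; omega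
  rw [Fin.tail_cons]
  rw [h, homogenize_le_iff hmm (by omega)] at hz
  exact ⟨h, hz⟩

theorem size_homogenize {x : Fin n → ℕ} {M : ℕ} (h : size x ≤ M) :
    size (homogenize M x) = M := by
  rw [homogenize, size_cons]; omega

theorem isTPBasis_standardBasis (a : Fin n → ℕ) (m m' : ℕ) (hmm : m ≤ m') (hm' : m' ≤ size a) :
    IsTPBasis a m m' (standardBasis a m m') := by
  refine ⟨standardBasis_subset hmm, fun _ _ => Set.mem_univ _, ?_, ?_⟩
  · intro f hf g hg hfg
    funext ⟨x, hx⟩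
    have h := (isTropicalPlucker_extendCap hmm hf).eq_of_eq_on_basis
      (isTropicalPlucker_extendCap hmm hg) ?_ (homogenize m' x)
      ((homogenize_le_iff hmm hx.2.2).2 hx) (size_homogenize hx.2.2)
    · rwa [homogenize, extendCap_cons f _ hx, extendCap_cons g _ hx] at h
    · intro z hz hs hav
      obtain ⟨h1, h2⟩ := mem_truncBox_of_le_capBox hmm hz hs
      rw [h1, avoids4_homogenize_iff h2] at hav
      rw [h1, homogenize, extendCap_cons f _ h2, extendCap_cons g _ h2]
      exact congrFun hfg ⟨_, hav⟩
  · intro g _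
    classical
    obtain ⟨F, hF, hFg⟩ := exists_isTropicalPlucker (a := capBox a m m') (m := m')
      (by rw [capBox, size_cons]; omega)
      (fun z => if h : Fin.tail z ∈ standardBasis a m m' then g ⟨_, h⟩ else 0)
    refine ⟨_, mem_tpFunctions_of_isTropicalPlucker hmm hF, ?_⟩
    funext ⟨x, hx⟩
    have hb := standardBasis_subset hmm hx
    have := hFg (homogenize m' x) ((homogenize_le_iff hmm hb.2.2).2 hb)
      (size_homogenize hb.2.2) ((avoids4_homogenize_iff hb).2 hx)
    simp only [restrictTo]
    rw [this]
    simp only [homogenize, Fin.tail_cons, dif_pos hx]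

/-! ### The Boolean cube as the box with `a = 1`. -/

/-- The `0,1`-vector of a subset of `[n]`. -/
def ind (S : Finset (Fin n)) : Fin n → ℕ := fun i => if i ∈ S then 1 else 0

/-- The support of a vector, as a finite set. -/
def supp (x : Fin n → ℕ) : Finset (Fin n) := Finset.univ.filter fun i => x i ≠ 0

theorem mem_supp {x : Fin n → ℕ} {i : Fin n} : i ∈ supp x ↔ x i ≠ 0 := by simp [supp]

theorem ind_ne_zero_iff {S : Finset (Fin n)} {i : Fin n} : ind S i ≠ 0 ↔ i ∈ S := by simp [ind]

theorem supp_ind (S : Finset (Fin n)) : supp (ind S) = S := by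
  ext i; rw [mem_supp, ind_ne_zero_iff]

theorem ind_le_one (S : Finset (Fin n)) : ind S ≤ 1 := by
  intro i
  simp only [ind, Pi.one_apply]
  split_ifs <;> omega

theorem ind_supp {x : Fin n → ℕ} (hx : x ≤ 1) : ind (supp x) = x := by
  funext i
  have : x i ≤ 1 := hx i
  simp only [ind, mem_supp]
  split_ifs <;> omega

theorem size_ind (S : Finset (Fin n)) : size (ind S) = S.card := by
  simp [size, ind]

theorem ind_mem_truncBox_iff {S : Finset (Fin n)} {m m' : ℕ} :
    ind S ∈ truncBox 1 m m' ↔ S ∈ truncCube n m m' := by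
  simp [truncBox, truncCube, size_ind, ind_le_one]

theorem supp_mem_truncCube {x : Fin n → ℕ} {m m' : ℕ} (hx : x ∈ truncBox 1 m m') :
    supp x ∈ truncCube n m m' := by
  rw [← ind_mem_truncBox_iff, ind_supp hx.1]
  exact hx

theorem supp_add_unitVec (X : Fin n → ℕ) (i : Fin n) :
    supp (X + unitVec i) = supp X ∪ {i} := by
  ext p
  simp only [mem_supp, Pi.add_apply, unitVec_apply, Finset.mem_union, Finset.mem_singleton]
  split_ifs <;> simp_all

theorem supp_add_add (X : Fin n → ℕ) (i j : Fin n) :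
    supp (X + unitVec i + unitVec j) = supp X ∪ {i, j} := by
  ext p
  simp only [mem_supp, Pi.add_apply, unitVec_apply, Finset.mem_union, Finset.mem_insert,
    Finset.mem_singleton]
  split_ifs <;> simp_all

theorem ind_union_singleton {X : Finset (Fin n)} {i : Fin n} (hi : i ∉ X) :
    ind (X ∪ {i}) = ind X + unitVec i := by
  funext p
  simp only [ind, Finset.mem_union, Finset.mem_singleton, Pi.add_apply, unitVec_apply]
  by_cases h : p = i
  · subst h; simp [hi]
  · simp [h]

theorem ind_union_pair {X : Finset (Fin n)} {i j : Fin n} (hi : i ∉ X) (hj : j ∉ X)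
    (hij : i ≠ j) : ind (X ∪ {i, j}) = ind X + unitVec i + unitVec j := by
  rw [← ind_union_singleton hi, ← ind_union_singleton (by simp [hj, hij.symm])]
  congr 1
  ext p
  simp

theorem notMem_supp_of_add_le {X : Fin n → ℕ} {i : Fin n} (h : X + unitVec i ≤ 1) :
    i ∉ supp X := by
  have : (X + unitVec i) i ≤ 1 := h i
  rw [Pi.add_apply, unitVec_self] at this
  rw [mem_supp]
  omega

theorem notMem_supp_of_add_add_le {X : Fin n → ℕ} {i j : Fin n}
    (h : X + unitVec i + unitVec j ≤ 1) : i ∉ supp X ∧ j ∉ supp X :=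
  ⟨notMem_supp_of_add_le (le_trans le_self_add h),
    notMem_supp_of_add_le (le_trans le_self_add (add_right_comm X (unitVec i) (unitVec j) ▸ h))⟩

theorem comp_supp_mem_tpFunctions {m m' : ℕ} {f : truncCube n m m' → ℝ}
    (hf : f ∈ boolTPFunctions n m m') :
    (fun x : truncBox 1 m m' => f ⟨supp x.1, supp_mem_truncCube x.2⟩) ∈ tpFunctions 1 m m' := by
  constructor
  · intro X i j k hij hjk hik hj hij' hk hi hjk'
    have h := hf.1 (supp X) i j k hij hjk (notMem_supp_of_add_le hi.1)
      (notMem_supp_of_add_le hj.1) (notMem_supp_of_add_le hk.1)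
    simp only [supp_add_add]
    simp only [supp_add_unitVec]
    apply h
  · intro X i j k l hij hjk hkl hik hjl hij' hkl' hil hjk'
    have h := hf.2 (supp X) i j k l hij hjk hkl (notMem_supp_of_add_add_le hij'.1).1
      (notMem_supp_of_add_add_le hij'.1).2 (notMem_supp_of_add_add_le hkl'.1).1
      (notMem_supp_of_add_add_le hkl'.1).2
    simp only [supp_add_add]
    apply h

theorem comp_ind_mem_boolTPFunctions {m m' : ℕ} {F : truncBox (1 : Fin n → ℕ) m m' → ℝ}
    (hF : F ∈ tpFunctions 1 m m') :
    (fun S : truncCube n m m' => F ⟨ind S.1, ind_mem_truncBox_iff.2 S.2⟩) ∈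
      boolTPFunctions n m m' := by
  constructor
  · intro X i j k hij hjk hi hj hk _ _ _ _ _ _
    have h := hF.1 (ind X) i j k hij hjk
    simp only [ind_union_pair hi hj hij.ne, ind_union_pair hj hk hjk.ne,
      ind_union_pair hi hk (hij.trans hjk).ne, ind_union_singleton hi, ind_union_singleton hj,
      ind_union_singleton hk]
    apply h
  · intro X i j k l hij hjk hkl hi hj hk hl _ _ _ _ _ _
    have h := hF.2 (ind X) i j k l hij hjk hkl
    simp only [ind_union_pair hi hj hij.ne, ind_union_pair hj hk hjk.ne,
      ind_union_pair hi hk (hij.trans hjk).ne, ind_union_pair hk hl hkl.ne,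
      ind_union_pair hj hl (hjk.trans hkl).ne, ind_union_pair hi hl (hij.trans (hjk.trans hkl)).ne]
    apply h

theorem isFint_ind_iff {S : Finset (Fin n)} :
    IsFint 1 (ind S) ↔ ∃ c d : Fin n, c ≤ d ∧ S = Finset.Icc c d := by
  constructor
  · rintro ⟨-, c, d, hc, hd, h⟩
    have hcS : c ∈ S := ind_ne_zero_iff.1 hc.1
    have hdS : d ∈ S := ind_ne_zero_iff.1 hd.1
    refine ⟨c, d, hc.2 hd.1, ?_⟩
    ext i
    rw [Finset.mem_Icc]
    constructor
    · intro hi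
      exact ⟨hc.2 (ind_ne_zero_iff.2 hi), hd.2 (ind_ne_zero_iff.2 hi)⟩
    · rintro ⟨h1, h2⟩
      rcases h1.lt_or_eq with h1 | rfl
      · rcases h2.lt_or_eq with h2 | rfl
        · rw [← ind_ne_zero_iff, h i h1 h2]; exact one_ne_zero
        · exact hdS
      · exact hcS
  · rintro ⟨c, d, hcd, rfl⟩
    refine isFint_iff.2 ⟨ind_le_one _, fun h => ?_, fun i j k hij hjk hi hk => ?_⟩
    · have := congrFun h c
      simp [ind, hcd] at this
    · rw [ind_ne_zero_iff, Finset.mem_Icc] at hi hk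
      simp [ind, hi.1.trans hij.le, hjk.le.trans hk.2]

theorem isSint_ind_iff {S : Finset (Fin n)} :
    IsSint 1 (ind S) ↔ ∃ d₁ c₂ d₂ : Fin n, (d₁ : ℕ) + 1 < (c₂ : ℕ) ∧ c₂ ≤ d₂ ∧
      S = Finset.Iic d₁ ∪ Finset.Icc c₂ d₂ := by
  constructor
  · rintro ⟨-, hnf, x', x'', hx', ⟨-, c, d, hc, hd, h⟩, hx, d', c'', hd', hc'', hlt, hfull⟩
    obtain rfl := hc.unique hc''
    have hS : S = Finset.Iic d' ∪ Finset.Icc c d := by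
      ext i
      rw [← ind_ne_zero_iff, hx, Finset.mem_union, Finset.mem_Iic, Finset.mem_Icc, Pi.add_apply]
      constructor
      · intro hi
        by_cases h1 : x' i = 0
        · have h2 : x'' i ≠ 0 := by omega
          exact Or.inr ⟨hc.2 h2, hd.2 h2⟩
        · exact Or.inl (hd'.2 h1)
      · rintro (h1 | ⟨h1, h2⟩)
        · have : x' i ≠ 0 := by
            rcases h1.lt_or_eq with h1 | rfl
            · rw [hfull i h1]; exact one_ne_zero
            · exact hd'.1
          omega
        · have : x'' i ≠ 0 := by
            rcases h1.lt_or_eq with h1 | rfl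
            · rcases h2.lt_or_eq with h2 | rfl
              · rw [h i h1 h2]; exact one_ne_zero
              · exact hd.1
            · exact hc.1
          omega
    refine ⟨d', c, d, ?_, hc.2 hd.1, hS⟩
    -- Without a gap between `d'` and `c` the set is one initial interval, hence a fint.
    by_contra hcon
    have hcd : c ≤ d := hc.2 hd.1
    have hn : 0 < n := d.pos
    refine hnf (isFint_ind_iff.2 ⟨⟨0, hn⟩, d, Nat.zero_le _, ?_⟩)
    rw [hS]
    ext i
    simp only [Finset.mem_union, Finset.mem_Iic, Finset.mem_Icc, Fin.le_def,
      Fin.lt_def] at hlt hcd ⊢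
    omega
  · rintro ⟨d₁, c₂, d₂, h1, h2, rfl⟩
    have hn : 0 < n := d₂.pos
    have e : Finset.Iic d₁ = Finset.Icc ⟨0, hn⟩ d₁ := by
      ext i
      simp only [Finset.mem_Iic, Finset.mem_Icc, Fin.le_def, Nat.zero_le, true_and]
    refine ⟨ind_le_one _, fun hf => ?_, ind (Finset.Iic d₁), ind (Finset.Icc c₂ d₂), ?_,
      isFint_ind_iff.2 ⟨c₂, d₂, h2, rfl⟩, ?_, d₁, c₂, ⟨?_, ?_⟩, ⟨?_, ?_⟩, ?_, ?_⟩
    -- The index `d₁ + 1` lies in the gap and violates `Avoids3` between `d₁` and `c₂`.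
    · have h3 := (isFint_iff.1 hf).2.2 d₁ ⟨d₁ + 1, by omega⟩ c₂ (by simp [Fin.lt_def])
        (by simpa [Fin.lt_def] using h1) (by simp [ind]) (by simp [ind, h2])
      have h4 : ¬ c₂ ≤ ⟨(d₁ : ℕ) + 1, by omega⟩ := by simpa [Fin.le_def] using h1
      simp [ind, h4] at h3
      simp [Fin.le_def] at h3
    · exact isFint_ind_iff.2 ⟨⟨0, hn⟩, d₁, Nat.zero_le _, e⟩
    · funext i
      simp only [ind, Pi.add_apply, Finset.mem_union, Finset.mem_Iic, Finset.mem_Icc, Fin.le_def]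
      split_ifs <;> omega
    · simp [ind]
    · intro i hi
      rw [Function.mem_support, ind_ne_zero_iff, Finset.mem_Iic] at hi
      exact hi
    · simp [ind, h2]
    · intro i hi
      rw [Function.mem_support, ind_ne_zero_iff, Finset.mem_Icc] at hi
      exact hi.1
    · rw [Fin.lt_def]; omega
    · intro i hi
      simp [ind, hi.le]

theorem ind_mem_standardBasis_iff {S : Finset (Fin n)} {m m' : ℕ} :
    ind S ∈ standardBasis 1 m m' ↔ S ∈ boolBasis n m m' ∪ {S | m = 0 ∧ S = ∅} := by
  have h0 : ind S = 0 ↔ S = ∅ := by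
    constructor
    · intro h
      rw [← supp_ind S, h]
      simp [supp]
    · rintro rfl
      funext i
      simp [ind]
  simp only [standardBasis, boolBasis, sints, fints, sesquiIntervals, intervals, Set.mem_union,
    Set.mem_ofPred_eq, Set.mem_iUnion, isFint_ind_iff, isSint_ind_iff, size_ind, h0]

theorem bijOn_boolTPFunctions {m m' : ℕ} (hmm : m ≤ m') (hm' : m' ≤ n) :
    ∃ h : boolBasis n m m' ∪ {S | m = 0 ∧ S = ∅} ⊆ truncCube n m m',
      Set.BijOn (restrictTo h) (boolTPFunctions n m m') Set.univ := by
  obtain ⟨hsub, hbij⟩ := isTPBasis_standardBasis (1 : Fin n → ℕ) m m' hmm (by simpa [size])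
  have hmem : ∀ x : Fin n → ℕ, x ∈ standardBasis 1 m m' →
      supp x ∈ boolBasis n m m' ∪ {S | m = 0 ∧ S = ∅} := fun x hx => by
    rw [← ind_mem_standardBasis_iff, ind_supp (hsub hx).1]
    exact hx
  refine ⟨fun S hS => ind_mem_truncBox_iff.1 (hsub (ind_mem_standardBasis_iff.2 hS)),
    fun _ _ => Set.mem_univ _, ?_, ?_⟩
  · intro f hf g hg hfg
    have h := hbij.injOn (comp_supp_mem_tpFunctions hf) (comp_supp_mem_tpFunctions hg)
      (funext fun x => congrFun hfg ⟨supp x.1, hmem x.1 x.2⟩)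
    funext S
    have := congrFun h ⟨ind S.1, ind_mem_truncBox_iff.2 S.2⟩
    simpa only [supp_ind] using this
  · intro g _
    obtain ⟨F, hF, hFg⟩ := hbij.surjOn
      (Set.mem_univ (fun x : standardBasis 1 m m' => g ⟨supp x.1, hmem x.1 x.2⟩))
    refine ⟨_, comp_ind_mem_boolTPFunctions hF, ?_⟩
    funext S
    have := congrFun hFg ⟨ind S.1, ind_mem_standardBasis_iff.2 S.2⟩
    simpa only [restrictTo, supp_ind] using this

theorem empty_notMem_boolBasis (n m m' : ℕ) : (∅ : Finset (Fin n)) ∉ boolBasis n m m' := by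
  simp only [boolBasis, sesquiIntervals, intervals, Set.mem_union, Set.mem_ofPred_eq,
    Set.mem_iUnion]
  rintro (⟨⟨d₁, c₂, d₂, -, -, h⟩, -⟩ | ⟨p, -, ⟨c, d, h1, h⟩, -⟩)
  · have : d₁ ∈ (∅ : Finset (Fin n)) := by rw [h]; simp
    simp at this
  · have : c ∈ (∅ : Finset (Fin n)) := by rw [h]; simp [h1]
    simp at this

/-- When `m = 0` the empty set is one more basis element, outside `boolBasis`; the normalization
prescribes the value `0` there. -/
theorem bijOn_boolTPFunctionsZero {m m' : ℕ} (hmm : m ≤ m') (hm' : m' ≤ n) :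
    ∃ h : boolBasis n m m' ⊆ truncCube n m m',
      Set.BijOn (restrictTo h) (boolTPFunctionsZero n m m') Set.univ := by
  obtain ⟨hsub, hbij⟩ := bijOn_boolTPFunctions hmm hm'
  refine ⟨Set.subset_union_left.trans hsub, fun _ _ => Set.mem_univ _, ?_, ?_⟩
  · intro f hf g hg hfg
    refine hbij.injOn hf.1 hg.1 ?_
    funext ⟨S, hS⟩
    rcases hS with hS | ⟨rfl, rfl⟩
    · exact congrFun hfg ⟨S, hS⟩
    · exact (hf.2 _).trans (hg.2 _).symm
  · intro g _
    classical
    obtain ⟨f, hf, hfg⟩ := hbij.surjOn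
      (Set.mem_univ (fun S : (boolBasis n m m' ∪ {S | m = 0 ∧ S = ∅} : Set (Finset (Fin n))) =>
        if h : S.1 ∈ boolBasis n m m' then g ⟨S.1, h⟩ else 0))
    refine ⟨f, ⟨hf, fun h => ?_⟩, ?_⟩
    · have hm0 : m = 0 := Nat.le_zero.1 h.1
      have := congrFun hfg ⟨∅, Or.inr ⟨hm0, rfl⟩⟩
      rwa [dif_neg (empty_notMem_boolBasis n m m')] at this
    · funext ⟨S, hS⟩
      have := congrFun hfg ⟨S, Or.inl hS⟩
      rwa [dif_pos hS] at this

end TropicalPlucker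

open TropicalPlucker in
theorem theoremA (n : ℕ) :
    -- the standard basis is a TP-basis of the truncated box
    (∀ (a : Fin n → ℕ) (m m' : ℕ), m ≤ m' → m' ≤ size a →
      IsTPBasis a m m' (standardBasis a m m')) ∧
    -- the Boolean version, for functions vanishing at the empty set when `m = 0`
    (∀ m m' : ℕ, m ≤ m' → m' ≤ n →
      ∃ h : boolBasis n m m' ⊆ truncCube n m m',
        Set.BijOn (restrictTo h) (boolTPFunctionsZero n m m') Set.univ) ∧
    -- the Boolean version without normalization, the empty set being a basis element when `m = 0`
    (∀ m m' : ℕ, m ≤ m' → m' ≤ n →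
      ∃ h : boolBasis n m m' ∪ {S | m = 0 ∧ S = ∅} ⊆ truncCube n m m',
        Set.BijOn (restrictTo h) (boolTPFunctions n m m') Set.univ) :=
  ⟨isTPBasis_standardBasis, fun _ _ => bijOn_boolTPFunctionsZero, fun _ _ => bijOn_boolTPFunctions⟩
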